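/- Let $k$ be a field of characteristic $p\ge 0$. For a $k$-algebra $A$ and an indeterminate $U$, a $k$-algebra homomorphism $\phi=\phi_U:A\to A[U]$ is called an \emph{exponential map} on $A$ if (i) composing $\phi_U$ with the evaluation $A[U]\to A$ at $U=0$ gives the identity of $A$, and (ii) $\phi_V\phi_U=\phi_{V+U}$ as maps $A\to A[U,V]$, where $V$ is a second indeterminate, $\phi_V: A\to A[V]$ is $\phi_U$ with $V$ in place of $U$, and on the left-hand side $\phi_V$ is extended to a homomorphism $A[U]\to A[U,V]$ by $\phi_V(U)=U$. It is \emph{non-trivial} if $A^{\phi}:=\{x\in A\mid \phi(x)=x\}\neq A$, and $A$ is \emph{rigid} if it has no non-trivial exponential map. Put $$F_3=\{(a_1,a_2,a_3)\in\mathbb Z_{>0}^3 \mid p\nmid \gcd(a_1,a_2,a_3)\},$$ $$T_3=\{(a_1,a_2,a_3)\in\mathbb Z_{>0}^3 \mid a_i=1 \text{ for some } i,\text{ or } a_i=a_j=2 \text{ for some } i\ne j\},$$ $$R_3=\{(a_1,a_2,a_3)\in\mathbb Z_{>0}^3 \mid a_i=1 \text{ for some } i,\text{ or } a_i=p^r,\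 a_j=sp^e \text{ for some } i\neq j \text{ and } r,s,e\in\mathbb Z_{>0} \text{ with } r\le e\}.$$ Theorem. If $(a,b,c)\in F_3\setminus(R_3\cup T_3)$ and $\gcd(a,bc)=1$, then $B_{(a,b,c)}:=k[X,Y,Z]/(X^a+Y^b+Z^c)$ is an integral domain and it is rigid. -/

import Mathlib

namespace PhamBrieskorn

open Polynomial

section Exponential

variable {k A : Type*} [CommRing k] [CommRing A] [Algebra k A]

/-- A `k`-algebra homomorphism `φ = φ_U : A → A[U]` is an exponential map on `A` if
evaluating at `U = 0` gives the identity and `φ_V φ_U = φ_{V+U}`.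
Here `A[U, V]` is realised as `A[V][U] = A[X][X]`: the outer variable `X` is `U` and the inner
variable `C X` is `V`.  The extension of `φ_V` to `A[U]` with `U ↦ U` is
`Polynomial.map φ`, and `φ_{V+U}(x)` is `φ(x)` with `V + U` substituted for its variable. -/
structure IsExponentialMap (φ : A →ₐ[k] A[X]) : Prop where
  eval_zero : ∀ x : A, (φ x).eval 0 = x
  comp : ∀ x : A,
    (φ x).map (φ : A →+* A[X]) =
      (φ x).eval₂ ((C : A[X] →+* A[X][X]).comp (C : A →+* A[X])) (C X + X)

/-- The set `A^φ` of invariants of `φ`. -/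
def invariants (φ : A →ₐ[k] A[X]) : Set A := {x | φ x = C x}

variable (k A) in
/-- A `k`-algebra is rigid if it has no non-trivial exponential map, an exponential map being
non-trivial when its invariants are not all of `A`. -/
def IsRigid : Prop :=
  ¬ ∃ φ : A →ₐ[k] A[X], IsExponentialMap φ ∧ invariants φ ≠ Set.univ

end Exponential

/-- The ring `k[X_1, …, X_n] / (X_1^{a_1} + ⋯ + X_n^{a_n})`. -/
abbrev PBRing (k : Type*) [Field k] {n : ℕ} (a : Fin n → ℕ) : Type _ :=
  MvPolynomial (Fin n) k ⧸
    Ideal.span {∑ i : Fin n, (MvPolynomial.X i : MvPolynomial (Fin n) k) ^ a i}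

/-- Tuples of positive integers whose greatest common divisor is not divisible by `p`. -/
def setF (p n : ℕ) : Set (Fin n → ℕ) :=
  {a | (∀ i, 0 < a i) ∧ ¬ p ∣ Finset.univ.gcd a}

/-- Tuples of positive integers in which some entry is `1` or two entries are equal to `2`. -/
def setT (n : ℕ) : Set (Fin n → ℕ) :=
  {a | (∀ i, 0 < a i) ∧ ((∃ i, a i = 1) ∨ ∃ i j, i ≠ j ∧ a i = 2 ∧ a j = 2)}

/-- Tuples of positive integers in which some entry is `1`, or which have two entries
`p ^ r` and `s * p ^ e` in different positions, with `r, s, e > 0` and `r ≤ e`. -/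
def setR (p n : ℕ) : Set (Fin n → ℕ) :=
  {a | (∀ i, 0 < a i) ∧
    ((∃ i, a i = 1) ∨
      ∃ i j, i ≠ j ∧ ∃ r s e : ℕ, 0 < r ∧ 0 < s ∧ 0 < e ∧ r ≤ e ∧
        a i = p ^ r ∧ a j = s * p ^ e)}

end PhamBrieskorn

/-!
Write `b = b' * g` and `c = c' * g` with `b'`, `c'` coprime, and let `B` be the ring
`k[X, Y, Z] / (X ^ a + Y ^ b + Z ^ c)` with the classes `x`, `y`, `z` of the variables. Since `a` is
prime to `b * c`, the weights `(b' c' g, a c', a b')` make `B` a graded ring in which every homogeneous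
element is a monomial in `x`, `y`, `z` times a binary form in `y ^ b'` and `z ^ c'`
(`exists_eq_mon_mul`). This structure shows that `B` embeds into a polynomial ring in two
variables, so `B` is a domain (`isDomain_PBRing`).

For rigidity, suppose that `B` has a non-trivial exponential map `φ`. The top homogeneous part of `φ`
is again a non-trivial exponential map `ψ` (`exists_homogeneous_exponentialMap`). It has a homogeneous
invariant `f` of positive degree (`exists_homogeneous_invariant`), and a homogeneous element `t` whose
image under `ψ` has the smallest positive degree in `U` (`exists_homogeneous_minimal`). As for every
exponential map on a domain, inverting the invariants turns `B` into a polynomial ring in `t`; extending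
scalars to an algebraically closed field `L`, this embeds `B` into `L[T]`, with `t` going to `T` and the
invariants going to constants (`IsExponentialMap.exists_algHom`).

Over `L` binary forms split into linear forms, so the images of `f` and of `t` are products of
"basic factors": `x`, `y`, `z` and `α y ^ b' + β z ^ c'`. Hence some basic factor is a non-zero constant
and some basic factor has degree one in `T`. Both together are impossible
(`false_of_basicFactors`). For instance, if `x` is constant and `z` is linear in `T`, then a root of
`z ^ c - const` has multiplicity `q ^ e`, the largest power of the characteristic exponent `q` that
divides `c`, and `y ^ b` has a root of the same multiplicity, so `b` divides `q ^ e`: this is what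
the set `R` excludes. The remaining cases compare root multiplicities and degrees in the same way.
-/

namespace PhamBrieskorn

open Polynomial

/-! ### The substitution `U ↦ V + U` and pseudo-division -/

section Polynomials

variable {A : Type*} [CommRing A]

/-- The substitution `U ↦ V + U`, as a ring homomorphism `A[U] → A[V][U]`. -/
noncomputable def shift (A : Type*) [CommRing A] : A[X] →+* A[X][X] :=
  eval₂RingHom ((C : A[X] →+* A[X][X]).comp (C : A →+* A[X])) (C X + X)

theorem coeff_coeff_shift (f : A[X]) (i j : ℕ) :
    ((shift A f).coeff i).coeff j = (i + j).choose i * f.coeff (i + j) := by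
  induction f using Polynomial.induction_on' with
  | add f g hf hg => simp only [map_add, coeff_add, hf, hg, mul_add]
  | monomial n r =>
    have h : shift A (monomial n r) = C (C r) * (X + C X) ^ n := by
      simp [shift, eval₂_monomial, add_comm]
    rw [h, coeff_C_mul, coeff_C_mul, coeff_X_add_C_pow, coeff_monomial, ← C_eq_natCast, coeff_mul_C,
      coeff_X_pow]
    rcases lt_or_ge n i with hn | hn
    · rw [Nat.choose_eq_zero_of_lt hn, if_neg (by omega : n ≠ i + j)]
      simp
    · by_cases hj : n = i + j
      · subst hj
        simp [mul_comm]
      · rw [if_neg (by omega : ¬ j = n - i), if_neg hj]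
        simp

theorem coeff_zero_shift (f : A[X]) : (shift A f).coeff 0 = f := by
  ext j
  simp [coeff_coeff_shift]

theorem degree_shift_le (f : A[X]) : (shift A f).degree ≤ f.degree := by
  rw [degree_le_iff_coeff_zero]
  intro m hm
  ext j
  rw [coeff_coeff_shift, coeff_eq_zero_of_degree_lt (hm.trans_le
    (by exact_mod_cast Nat.le_add_right m j)),
    mul_zero, coeff_zero]

theorem natDegree_lt_of_degree_lt_of_pos {p q : A[X]} (hq : 0 < q.natDegree)
    (h : p.degree < q.degree) : p.natDegree < q.natDegree := by
  rcases eq_or_ne p 0 with rfl | hp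
  · simpa using hq
  · exact natDegree_lt_natDegree hp h

/-- Division with remainder by `g`, after multiplying by a power of its leading coefficient. -/
theorem exists_pseudoDivision (g : A[X]) (hg : 0 < g.natDegree) (f : A[X]) :
    ∃ (N : ℕ) (q r : A[X]), C g.leadingCoeff ^ N * f = q * g + r ∧ r.degree < g.degree := by
  induction hn : f.natDegree using Nat.strong_induction_on generalizing f with
  | _ n ih =>
    rcases lt_or_ge f.degree g.degree with h | h
    · exact ⟨0, 0, f, by simp, h⟩
    · have hg0 : g ≠ 0 := by rintro rfl; simp at hg
      have hf0 : f ≠ 0 := by rintro rfl; simp [hg0] at h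
      have hle : g.natDegree ≤ f.natDegree := natDegree_le_natDegree h
      set f' := C g.leadingCoeff * f - C f.leadingCoeff * X ^ (f.natDegree - g.natDegree) * g
        with hf'
      have hlt : f'.natDegree < n := by
        rw [← hn]
        have h1 : f'.natDegree ≤ f.natDegree := by
          refine (natDegree_sub_le _ _).trans (max_le (natDegree_C_mul_le _ _) ?_)
          refine natDegree_mul_le.trans ?_
          have := natDegree_C_mul_X_pow_le f.leadingCoeff (f.natDegree - g.natDegree)
          omega
        have h2 : f'.coeff f.natDegree = 0 := by
          rw [hf', coeff_sub, coeff_C_mul, mul_assoc, coeff_C_mul]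
          have : (X ^ (f.natDegree - g.natDegree) * g).coeff f.natDegree = g.leadingCoeff := by
            conv_lhs => rw [← Nat.sub_add_cancel hle]
            rw [Nat.add_sub_cancel, add_comm, coeff_X_pow_mul, leadingCoeff]
          rw [this, leadingCoeff, leadingCoeff]
          ring
        refine lt_of_le_of_ne h1 fun h3 => ?_
        have h4 : f' = 0 := by rw [← leadingCoeff_eq_zero, leadingCoeff, h3, h2]
        rw [h4, natDegree_zero] at h3
        omega
      obtain ⟨N, q, r, h1, h2⟩ := ih _ hlt f' rfl
      refine ⟨N + 1, C g.leadingCoeff ^ N * (C f.leadingCoeff * X ^ (f.natDegree - g.natDegree)) + q,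
        r, ?_, h2⟩
      rw [add_mul, add_assoc, ← h1, hf']
      ring

end Polynomials

/-! ### Exponential maps on a domain -/

section Exponential

variable {k A : Type*} [CommRing k] [CommRing A] [Algebra k A] {φ : A →ₐ[k] A[X]}

namespace IsExponentialMap

theorem coeff_zero (hφ : IsExponentialMap φ) (x : A) : (φ x).coeff 0 = x := by
  rw [coeff_zero_eq_eval_zero, hφ.eval_zero]

theorem map_eq_shift (hφ : IsExponentialMap φ) (x : A) :
    (φ x).map (φ : A →+* A[X]) = shift A (φ x) :=
  hφ.comp x

theorem coeff_coeff (hφ : IsExponentialMap φ) (x : A) (i j : ℕ) :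
    (φ ((φ x).coeff i)).coeff j = (i + j).choose i * (φ x).coeff (i + j) := by
  rw [← coeff_coeff_shift, ← hφ.map_eq_shift, coeff_map, RingHom.coe_coe]

/-- The iteration rule of an exponential map, read off coefficient by coefficient. -/
theorem of_coeff (h0 : ∀ x, (φ x).coeff 0 = x)
    (h : ∀ x i j, (φ ((φ x).coeff i)).coeff j = (i + j).choose i * (φ x).coeff (i + j)) :
    IsExponentialMap φ where
  eval_zero x := by rw [← coeff_zero_eq_eval_zero, h0]
  comp x := by
    change _ = shift A (φ x)
    ext i j
    rw [coeff_coeff_shift, coeff_map, RingHom.coe_coe, h]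

theorem injective (hφ : IsExponentialMap φ) : Function.Injective φ := fun x y h => by
  rw [← hφ.coeff_zero x, h, hφ.coeff_zero]

theorem mem_invariants_iff (hφ : IsExponentialMap φ) (x : A) :
    x ∈ invariants φ ↔ (φ x).natDegree = 0 := by
  constructor
  · intro h
    rw [show φ x = C x from h, natDegree_C]
  · intro h
    change φ x = C x
    rw [eq_C_of_natDegree_eq_zero h, hφ.coeff_zero]

theorem leadingCoeff_mem (hφ : IsExponentialMap φ) (x : A) :
    (φ x).leadingCoeff ∈ invariants φ := by
  rw [hφ.mem_invariants_iff, ← Nat.le_zero, natDegree_le_iff_coeff_eq_zero]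
  intro j hj
  rw [leadingCoeff, hφ.coeff_coeff, coeff_eq_zero_of_natDegree_lt (by omega), mul_zero]

end IsExponentialMap

variable [IsDomain A]

/-- Pseudo-division by `φ t` of an element in the image of `φ` stays in the image of `φ`: by
uniqueness of the quotient and the remainder, both satisfy the iteration rule. -/
theorem IsExponentialMap.exists_division (hφ : IsExponentialMap φ) {t : A}
    (ht : 0 < (φ t).natDegree) (f : A) :
    ∃ (N : ℕ) (q r : A), (φ t).leadingCoeff ^ N * f = q * t + r ∧
      (φ r).natDegree < (φ t).natDegree := by
  obtain ⟨N, Q, R, h1, h2⟩ := exists_pseudoDivision (φ t) ht (φ f)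
  set α := (φ t).leadingCoeff with hα
  have hαφ : φ α = C α := hφ.leadingCoeff_mem t
  have ht0 : φ t ≠ 0 := by intro h; simp [h] at ht
  have e1 := congrArg (Polynomial.map (φ : A →+* A[X])) h1
  have e2 := congrArg (shift A) h1
  simp only [Polynomial.map_mul, Polynomial.map_pow, Polynomial.map_add, map_C, hφ.map_eq_shift,
    RingHom.coe_coe, hαφ] at e1
  have hsC : shift A (C α) = C (C α) := by simp [shift]
  rw [map_mul, map_pow, map_add, map_mul, hsC] at e2
  have hinj : Function.Injective (φ : A →+* A[X]) := hφ.injective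
  have hdegt : (shift A (φ t)).degree = (φ t).degree := by
    rw [← hφ.map_eq_shift, degree_map_eq_of_injective hinj]
  have e3 : (Q.map (φ : A →+* A[X]) - shift A Q) * shift A (φ t) =
      shift A R - R.map (φ : A →+* A[X]) := by
    linear_combination e2 - e1
  have hQ : Q.map (φ : A →+* A[X]) = shift A Q := by
    by_contra hne
    have hne' := sub_ne_zero.mpr hne
    have h3 : (shift A R - R.map (φ : A →+* A[X])).degree < (φ t).degree := by
      refine (degree_sub_le _ _).trans_lt (max_lt ((degree_shift_le R).trans_lt h2) ?_)
      rwa [degree_map_eq_of_injective hinj]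
    rw [← e3, degree_mul, hdegt, degree_eq_natDegree hne', degree_eq_natDegree ht0] at h3
    norm_cast at h3
    omega
  have hR : R.map (φ : A →+* A[X]) = shift A R := by
    rw [hQ, sub_self, zero_mul] at e3
    exact (sub_eq_zero.mp e3.symm).symm
  have key : ∀ S : A[X], S.map (φ : A →+* A[X]) = shift A S → φ (S.coeff 0) = S := by
    intro S hS
    rw [← RingHom.coe_coe φ, ← coeff_map, hS, coeff_zero_shift]
  refine ⟨N, Q.coeff 0, R.coeff 0, hφ.injective ?_, ?_⟩
  · rw [map_mul, map_pow, map_add, map_mul, key Q hQ, key R hR, hαφ, h1]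
  · rw [key R hR]
    exact natDegree_lt_of_degree_lt_of_pos ht h2

/-- If `t` has the smallest positive degree under `φ`, then over a field containing `A` every `φ f`
is a polynomial in `φ t`.  In other words `A` becomes a subring of a polynomial ring in the
single variable `t` once the invariants are inverted. -/
theorem IsExponentialMap.exists_eq_comp (hφ : IsExponentialMap φ) {t : A}
    (ht : 0 < (φ t).natDegree)
    (hmin : ∀ f, (φ f).natDegree < (φ t).natDegree → (φ f).natDegree = 0)
    {L : Type*} [Field L] [Algebra A L] [FaithfulSMul A L] (f : A) :
    ∃ P : L[X], (φ f).map (algebraMap A L) = P.comp ((φ t).map (algebraMap A L)) := by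
  induction hn : (φ f).natDegree using Nat.strong_induction_on generalizing f with
  | _ n ih =>
    obtain ⟨N, q, r, h1, h2⟩ := hφ.exists_division ht f
    have hr : φ r = C r := (hφ.mem_invariants_iff r).mpr (hmin r h2)
    set α := (φ t).leadingCoeff with hα
    have ht0 : φ t ≠ 0 := by intro h; simp [h] at ht
    have hα0 : α ≠ 0 := leadingCoeff_ne_zero.mpr ht0
    have hαφ : φ α = C α := hφ.leadingCoeff_mem t
    have h3 : C α ^ N * φ f = φ q * φ t + C r := by
      rw [← hαφ, ← map_pow, ← map_mul, h1, map_add, map_mul, hr]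
    have hα' : algebraMap A L α ≠ 0 := by simpa using hα0
    have fin : ∀ P : L[X], (φ q).map (algebraMap A L) = P.comp ((φ t).map (algebraMap A L)) →
        ∃ P : L[X], (φ f).map (algebraMap A L) = P.comp ((φ t).map (algebraMap A L)) := by
      intro P hP
      refine ⟨C ((algebraMap A L α ^ N)⁻¹) * (P * X + C (algebraMap A L r)), ?_⟩
      have h4 := congrArg (Polynomial.map (algebraMap A L)) h3
      simp only [Polynomial.map_mul, Polynomial.map_pow, Polynomial.map_add, map_C, hP] at h4
      rw [mul_comp, add_comp, mul_comp, C_comp, C_comp, X_comp, ← h4, ← C_pow, ← mul_assoc, ← C_mul,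
        inv_mul_cancel₀ (pow_ne_zero _ hα'), C_1, one_mul]
    rcases eq_or_ne q 0 with rfl | hq
    · exact fin 0 (by simp)
    · have hq' : φ q ≠ 0 := fun h => hq (hφ.injective (by rw [h, map_zero]))
      refine (ih _ ?_ q rfl).elim fin
      have h5 := congrArg natDegree h3
      rw [← C_pow, natDegree_C_mul (pow_ne_zero _ hα0), natDegree_add_C, natDegree_mul hq' ht0] at h5
      omega

/-- The embedding of `A` into a polynomial ring in one variable attached to an element `t` of
smallest positive degree under `φ`. -/
theorem IsExponentialMap.exists_algHom (hφ : IsExponentialMap φ) {t : A}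
    (ht : 0 < (φ t).natDegree)
    (hmin : ∀ f, (φ f).natDegree < (φ t).natDegree → (φ f).natDegree = 0)
    {L : Type*} [Field L] [Algebra A L] [FaithfulSMul A L] [Algebra k L] [IsScalarTower k A L] :
    ∃ ρ : A →ₐ[k] L[X], Function.Injective ρ ∧ ρ t = X ∧
      ∀ f, (φ f).natDegree = (ρ f).natDegree * (φ t).natDegree := by
  have hinjA : Function.Injective (algebraMap A L) := FaithfulSMul.algebraMap_injective A L
  set τ := (φ t).map (algebraMap A L) with hτ
  have hτd : τ.natDegree = (φ t).natDegree := natDegree_map_eq_of_injective hinjA _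
  choose P hP' using hφ.exists_eq_comp ht hmin (L := L)
  have hP : ∀ f, (P f).comp τ = (φ f).map (algebraMap A L) := fun f => (hP' f).symm
  have hcomp : Function.Injective fun Q : L[X] => Q.comp τ := by
    intro Q R h
    have h' : (Q - R).comp τ = 0 := by rw [sub_comp]; exact sub_eq_zero.mpr h
    rw [comp_eq_zero_iff] at h'
    rcases h' with h' | ⟨_, h'⟩
    · exact sub_eq_zero.mp h'
    · rw [h', natDegree_C] at hτd
      omega
  refine ⟨{ toFun := P, map_one' := hcomp ?_, map_mul' := fun x y => hcomp ?_,
            map_zero' := hcomp ?_, map_add' := fun x y => hcomp ?_,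
            commutes' := fun r => hcomp ?_ }, ?_, hcomp ?_, ?_⟩
  · simp [hP]
  · simp [hP, mul_comp]
  · simp [hP]
  · simp [hP, add_comp]
  · simp [hP, Polynomial.algebraMap_apply, ← IsScalarTower.algebraMap_apply]
  · intro x y h
    have h' : P x = P y := h
    apply hφ.injective
    apply Polynomial.map_injective _ hinjA
    rw [← hP, ← hP, h']
  · change (P t).comp τ = X.comp τ
    rw [hP, X_comp]
  · intro f
    change _ = (P f).natDegree * _
    rw [← hτd, ← natDegree_comp, hP, natDegree_map_eq_of_injective hinjA]

end Exponential

/-! ### Gradings -/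

section Grading

variable {k B : Type*} [CommRing k] [CommRing B] [Algebra k B]

/-- An `ℕ`-grading of the `k`-algebra `B`, encoded by the homomorphism `B → B[T]` that sends
`b = ∑ b_d` to `∑ b_d T^d`, where `b_d` is the homogeneous part of degree `d`. -/
structure IsGrading (γ : B →ₐ[k] B[X]) : Prop where
  eval_one : ∀ b, (γ b).eval 1 = b
  map_coeff : ∀ b d, γ ((γ b).coeff d) = monomial d ((γ b).coeff d)

/-- The homogeneous part of degree `m`, for an integer `m`; it vanishes for negative `m`. -/
noncomputable def homPart (γ : B →ₐ[k] B[X]) (m : ℤ) : B →ₗ[k] B :=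
  if 0 ≤ m then ((lcoeff B m.toNat).restrictScalars k).comp γ.toLinearMap else 0

variable {γ : B →ₐ[k] B[X]}

theorem homPart_natCast (n : ℕ) (b : B) : homPart γ n b = (γ b).coeff n := by
  simp [homPart]

theorem homPart_of_neg {m : ℤ} (hm : m < 0) (b : B) : homPart γ m b = 0 := by
  simp [homPart, not_le.mpr hm]

theorem homPart_of_map_eq {b : B} {n : ℕ} (h : γ b = monomial n b) (m : ℤ) :
    homPart γ m b = if m = n then b else 0 := by
  rcases lt_or_ge m 0 with hm | hm
  · rw [homPart_of_neg hm, if_neg (by omega)]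
  · lift m to ℕ using hm
    rw [homPart_natCast, h, coeff_monomial]
    simp [eq_comm]

theorem homPart_eq_zero_of_natDegree_le {b : B} {n : ℕ} (h : (γ b).natDegree ≤ n) {m : ℤ} (hm : n < m) :
    homPart γ m b = 0 := by
  lift m to ℕ using by omega
  rw [homPart_natCast, coeff_eq_zero_of_natDegree_lt (by omega)]

theorem homPart_mul_eq_sum (n : ℕ) (x y : B) :
    homPart γ n (x * y) =
      ∑ p ∈ Finset.HasAntidiagonal.antidiagonal n, homPart γ p.1 x * homPart γ p.2 y := by
  simp only [homPart_natCast, map_mul, coeff_mul]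

theorem homPart_algebraMap (n : ℤ) (r : k) :
    homPart γ n (algebraMap k B r) = if n = 0 then algebraMap k B r else 0 := by
  refine homPart_of_map_eq (n := 0) ?_ n
  simp [Polynomial.algebraMap_apply]

namespace IsGrading

theorem map_homPart (hγ : IsGrading γ) (n : ℕ) (b : B) :
    γ (homPart γ n b) = monomial n (homPart γ n b) := by
  rw [homPart_natCast, hγ.map_coeff]

theorem homPart_homPart (hγ : IsGrading γ) (m n : ℤ) (b : B) :
    homPart γ m (homPart γ n b) = if m = n then homPart γ n b else 0 := by
  rcases lt_or_ge n 0 with hn | hn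
  · simp [homPart_of_neg hn]
  · lift n to ℕ using hn
    rw [homPart_of_map_eq (hγ.map_homPart n b)]

theorem sum_homPart (hγ : IsGrading γ) (b : B) :
    ∑ n ∈ Finset.range ((γ b).natDegree + 1), homPart γ n b = b := by
  conv_rhs => rw [← hγ.eval_one b, eval_eq_sum_range]
  simp [homPart_natCast]

/-- A linear map is determined by its values on homogeneous elements. -/
theorem linearMap_ext (hγ : IsGrading γ) {M : Type*} [AddCommGroup M] [Module k M]
    {f g : B →ₗ[k] M} (h : ∀ (n : ℕ) b, f (homPart γ n b) = g (homPart γ n b)) : f = g := by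
  ext b
  rw [← hγ.sum_homPart b, map_sum, map_sum]
  exact Finset.sum_congr rfl fun n _ => h n b

theorem eq_zero_of_homPart (hγ : IsGrading γ) {b : B} (h : ∀ n : ℕ, homPart γ n b = 0) : b = 0 := by
  rw [← hγ.sum_homPart b]
  exact Finset.sum_eq_zero fun n _ => h n

/-- The part of degree `m + n` of a product of elements of degree at most `m` and `n`. -/
theorem homPart_mul (hγ : IsGrading γ) {x y : B} {m n : ℤ} (hx : ∀ e, m < e → homPart γ e x = 0)
    (hy : ∀ e, n < e → homPart γ e y = 0) :
    homPart γ (m + n) (x * y) = homPart γ m x * homPart γ n y := by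
  rcases lt_or_ge m 0 with hm | hm
  · have : x = 0 := hγ.eq_zero_of_homPart fun e => hx e (by omega)
    simp [this]
  rcases lt_or_ge n 0 with hn | hn
  · have : y = 0 := hγ.eq_zero_of_homPart fun e => hy e (by omega)
    simp [this]
  lift m to ℕ using hm
  lift n to ℕ using hn
  rw [← Nat.cast_add, homPart_natCast, homPart_natCast, homPart_natCast, map_mul]
  apply coeff_mul_add_eq_of_natDegree_le
  · rw [natDegree_le_iff_coeff_eq_zero]
    intro e he
    rw [← homPart_natCast, hx e (by omega)]
  · rw [natDegree_le_iff_coeff_eq_zero]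
    intro e he
    rw [← homPart_natCast, hy e (by omega)]

theorem homPart_mul_eq_zero (hγ : IsGrading γ) {x y : B} {m n : ℤ}
    (hx : ∀ e, m < e → homPart γ e x = 0) (hy : ∀ e, n < e → homPart γ e y = 0) {e : ℤ}
    (he : m + n < e) : homPart γ e (x * y) = 0 := by
  have := hγ.homPart_mul (m := m) (n := e - m) hx fun e' he' => hy e' (by omega)
  rw [show m + (e - m) = e by ring] at this
  rw [this, hy (e - m) (by omega), mul_zero]

/-- Multiplying all degrees by a positive integer. -/
theorem expand (hγ : IsGrading γ) {q : ℕ} (hq : 0 < q) :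
    IsGrading (((Polynomial.expand B q).restrictScalars k).comp γ) where
  eval_one b := by simp [hγ.eval_one, expand_eval]
  map_coeff b d := by
    simp only [AlgHom.comp_apply, AlgHom.restrictScalars_apply, coeff_expand hq]
    split_ifs with h
    · rw [hγ.map_coeff, expand_monomial, Nat.div_mul_cancel h]
    · simp

end IsGrading

/-! ### The homogeneous form of an exponential map -/

/-- For `F ∈ B[U]`, the part of `F` which is homogeneous of degree `d` when `U` has degree `-P`. -/
noncomputable def levelPart (γ : B →ₐ[k] B[X]) (P d : ℤ) : B[X] →ₗ[k] B[X] :=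
  lsum fun i => ((monomial i).restrictScalars k).comp (homPart γ (d + i * P))

theorem coeff_levelPart (P d : ℤ) (F : B[X]) (i : ℕ) :
    (levelPart γ P d F).coeff i = homPart γ (d + i * P) (F.coeff i) := by
  induction F using Polynomial.induction_on' with
  | add f g hf hg => simp only [map_add, coeff_add, hf, hg]
  | monomial n r =>
    have : levelPart γ P d (monomial n r) = monomial n (homPart γ (d + n * P) r) := by
      simp [levelPart, lsum_apply, sum_monomial_index]
    rw [this, coeff_monomial, coeff_monomial]
    split_ifs with h
    · rw [h]
    · simp

/-- The condition that `φ` does not raise degrees when `U` is given degree `-P`. -/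
def DegreeBound (γ φ : B →ₐ[k] B[X]) (P : ℤ) : Prop :=
  ∀ (d : ℤ) (b : B) (i : ℕ) (e : ℤ), d + i * P < e →
    homPart γ e ((φ (homPart γ d b)).coeff i) = 0

theorem homPart_mul_coeff_eq_zero (hγ : IsGrading γ) {F G : B[X]} {P m n : ℤ}
    (hF : ∀ (i : ℕ) (e : ℤ), m + i * P < e → homPart γ e (F.coeff i) = 0)
    (hG : ∀ (i : ℕ) (e : ℤ), n + i * P < e → homPart γ e (G.coeff i) = 0)
    (i : ℕ) (e : ℤ) (he : m + n + i * P < e) : homPart γ e ((F * G).coeff i) = 0 := by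
  rw [coeff_mul, map_sum]
  refine Finset.sum_eq_zero fun p hp => ?_
  have hp' : (p.1 : ℤ) + p.2 = i := by exact_mod_cast Finset.HasAntidiagonal.mem_antidiagonal.mp hp
  refine hγ.homPart_mul_eq_zero (hF p.1) (hG p.2) ?_
  rw [← hp'] at he
  linarith

theorem levelPart_mul (hγ : IsGrading γ) {F G : B[X]} {P m n : ℤ}
    (hF : ∀ (i : ℕ) (e : ℤ), m + i * P < e → homPart γ e (F.coeff i) = 0)
    (hG : ∀ (i : ℕ) (e : ℤ), n + i * P < e → homPart γ e (G.coeff i) = 0) :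
    levelPart γ P (m + n) (F * G) = levelPart γ P m F * levelPart γ P n G := by
  ext i
  rw [coeff_levelPart, coeff_mul, coeff_mul, map_sum]
  refine Finset.sum_congr rfl fun p hp => ?_
  have hp' : (p.1 : ℤ) + p.2 = i := by exact_mod_cast Finset.HasAntidiagonal.mem_antidiagonal.mp hp
  rw [coeff_levelPart, coeff_levelPart, ← hγ.homPart_mul (hF p.1) (hG p.2), ← hp',
    show m + n + ((p.1 : ℤ) + p.2) * P = m + p.1 * P + (n + p.2 * P) by ring]

/-- It suffices to check the degree bound on homogeneous generators. -/
theorem degreeBound_of_adjoin_eq_top (hγ : IsGrading γ) {φ : B →ₐ[k] B[X]} {P : ℤ} {s : Set B}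
    (hs : Algebra.adjoin k s = ⊤) {w : B → ℕ} (hw : ∀ x ∈ s, γ x = monomial (w x) x)
    (h : ∀ x ∈ s, ∀ (i : ℕ) (e : ℤ), w x + i * P < e → homPart γ e ((φ x).coeff i) = 0) :
    DegreeBound γ φ P := by
  intro d b
  have hb : b ∈ Algebra.adjoin k s := hs ▸ Algebra.mem_top
  induction hb using Algebra.adjoin_induction generalizing d with
  | mem x hx =>
    intro i e he
    rw [homPart_of_map_eq (hw x hx)] at *
    split_ifs with hd
    · exact h x hx i e (by omega)
    · simp
  | algebraMap r =>
    intro i e he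
    rw [homPart_algebraMap]
    split_ifs with hd
    · rw [AlgHom.commutes, Polynomial.algebraMap_apply, coeff_C]
      split_ifs with hi
      · subst hi
        rw [homPart_algebraMap, if_neg (by simp at he; omega)]
      · simp
    · simp
  | add x y _ _ hx hy =>
    intro i e he
    rw [map_add, map_add, coeff_add, map_add, hx d i e he, hy d i e he, add_zero]
  | mul x y _ _ hx hy =>
    intro i e he
    rcases lt_or_ge d 0 with hd | hd
    · simp [homPart_of_neg hd]
    lift d to ℕ using hd
    rw [homPart_mul_eq_sum, map_sum, finsetSum_coeff, map_sum]
    refine Finset.sum_eq_zero fun p hp => ?_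
    have hp' : (p.1 : ℤ) + p.2 = d := by exact_mod_cast Finset.HasAntidiagonal.mem_antidiagonal.mp hp
    rw [map_mul]
    exact homPart_mul_coeff_eq_zero hγ (hx p.1) (hy p.2) i e (by rwa [hp'])

/-- The top homogeneous part of an exponential map, with respect to a degree bound, is again an
exponential map. -/
theorem DegreeBound.exists_homogeneous (hγ : IsGrading γ) {φ : B →ₐ[k] B[X]}
    (hφ : IsExponentialMap φ) {P : ℤ} (hb : DegreeBound γ φ P) :
    ∃ ψ : B →ₐ[k] B[X], IsExponentialMap ψ ∧
      ∀ (d : ℤ) (b : B), ψ (homPart γ d b) = levelPart γ P d (φ (homPart γ d b)) := by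
  set f : B →ₗ[k] B[X] :=
    (lsum fun n => (levelPart γ P n).comp φ.toLinearMap).comp γ.toLinearMap with hf
  have hfn : ∀ (n : ℕ) (b : B), f (homPart γ n b) = levelPart γ P n (φ (homPart γ n b)) := by
    intro n b
    simp [hf, lsum_apply, hγ.map_homPart, sum_monomial_index]
  have hfd : ∀ (d : ℤ) (b : B), f (homPart γ d b) = levelPart γ P d (φ (homPart γ d b)) := by
    intro d b
    rcases lt_or_ge d 0 with hd | hd
    · simp [homPart_of_neg hd]
    · lift d to ℕ using hd
      exact hfn d b
  have hone : f 1 = 1 := by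
    have h1 : homPart γ 0 (1 : B) = 1 := by
      have := homPart_algebraMap (γ := γ) 0 1
      simpa using this
    have h2 := hfd 0 1
    rw [h1] at h2
    rw [h2, map_one]
    ext i
    rw [coeff_levelPart, coeff_one]
    split_ifs with hi
    · subst hi
      simpa using h1
    · simp
  have hmul : ∀ x y, f (x * y) = f x * f y := by
    have : (LinearMap.mul k B).compr₂ f = (LinearMap.mul k B[X]).compl₁₂ f f := by
      refine hγ.linearMap_ext fun m x => hγ.linearMap_ext fun n y => ?_
      simp only [LinearMap.compr₂_apply, LinearMap.mul_apply', LinearMap.compl₁₂_apply]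
      have hxy : homPart γ (m + n : ℤ) (homPart γ m x * homPart γ n y) =
          homPart γ m x * homPart γ n y := by
        rw [hγ.homPart_mul (m := m) (n := n), hγ.homPart_homPart, hγ.homPart_homPart, if_pos rfl,
          if_pos rfl]
        · intro e he
          rw [hγ.homPart_homPart, if_neg (by omega)]
        · intro e he
          rw [hγ.homPart_homPart, if_neg (by omega)]
      rw [← hxy, hfd, hxy, map_mul, hfn, hfn]
      exact levelPart_mul hγ (hb m x) (hb n y)
    intro x y
    exact LinearMap.congr_fun₂ this x y
  refine ⟨AlgHom.ofLinearMap f hone hmul, ?_, hfd⟩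
  refine IsExponentialMap.of_coeff (fun x => ?_) fun x i j => ?_
  · change ((lcoeff B 0).restrictScalars k ∘ₗ f) x = (LinearMap.id : B →ₗ[k] B) x
    congr 1
    refine hγ.linearMap_ext fun n b => ?_
    simp [hfn, coeff_levelPart, hφ.coeff_zero, hγ.homPart_homPart]
  · change ((lcoeff B j).restrictScalars k ∘ₗ f ∘ₗ (lcoeff B i).restrictScalars k ∘ₗ f) x =
      ((LinearMap.mulLeft k ((i + j).choose i : B)) ∘ₗ (lcoeff B (i + j)).restrictScalars k ∘ₗ f) x
    congr 1
    refine hγ.linearMap_ext fun n b => ?_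
    simp only [LinearMap.comp_apply, LinearMap.restrictScalars_apply, lcoeff_apply, hfn,
      coeff_levelPart, hfd, LinearMap.mulLeft_apply]
    set y := homPart γ n b
    -- Only the top part of `D_i y` contributes to the part of `D_j (D_i y)` of the extremal degree.
    have key : ∀ z : B, (∀ e, (n : ℤ) + i * P < e → homPart γ e z = 0) →
        homPart γ (n + i * P + j * P) ((φ (homPart γ (n + i * P) z)).coeff j) =
          homPart γ (n + i * P + j * P) ((φ z).coeff j) := by
      intro z hz
      conv_rhs => rw [← hγ.sum_homPart z, map_sum, finsetSum_coeff, map_sum]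
      rcases lt_or_ge ((n : ℤ) + i * P) 0 with hneg | hnn
      · have : z = 0 := hγ.eq_zero_of_homPart fun e => hz e (by omega)
        simp [this]
      obtain ⟨m, hm⟩ : ∃ m : ℕ, (m : ℤ) = n + i * P := ⟨_, Int.toNat_of_nonneg hnn⟩
      rw [← hm, Finset.sum_eq_single m]
      · intro e _ hne
        rcases lt_or_gt_of_ne hne with hlt | hgt
        · exact hb e z j _ (by omega)
        · rw [hz e (by omega)]
          simp
      · intro hmem
        have : homPart γ m z = 0 :=
          homPart_eq_zero_of_natDegree_le le_rfl (by rw [Finset.mem_range] at hmem; omega)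
        simp [this]
    have hnat : ∀ (c : ℕ) (m : ℤ) (z : B), homPart γ m (c * z) = c * homPart γ m z := by
      intro c m z
      rw [← nsmul_eq_mul, map_nsmul, nsmul_eq_mul]
    rw [key _ (hb n b i), hφ.coeff_coeff, hnat, Nat.cast_add, add_mul, add_assoc]

/-- A non-trivial exponential map on an algebra generated by finitely many homogeneous elements
gives rise to a non-trivial exponential map which is homogeneous: after the degrees have been
multiplied by some `q`, its `i`-th coefficient raises degrees by `i * P` for a fixed integer `P`. -/
theorem exists_homogeneous_exponentialMap (hγ : IsGrading γ) {φ : B →ₐ[k] B[X]}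
    (hφ : IsExponentialMap φ) (hne : invariants φ ≠ Set.univ) {s : Finset B}
    (hs : Algebra.adjoin k (s : Set B) = ⊤) {w : B → ℕ}
    (hw : ∀ x ∈ s, γ x = monomial (w x) x) :
    ∃ (q : ℕ) (_ : 0 < q) (P : ℤ) (γ' ψ : B →ₐ[k] B[X]),
      γ' = ((Polynomial.expand B q).restrictScalars k).comp γ ∧ IsExponentialMap ψ ∧
      invariants ψ ≠ Set.univ ∧
      ∀ (d : ℤ) (b : B) (i : ℕ),
        (ψ (homPart γ' d b)).coeff i = homPart γ' (d + i * P) ((ψ b).coeff i) := by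
  classical
  set T := s.sigma fun x => ((φ x).support.erase 0).sigma fun i => (γ ((φ x).coeff i)).support
    with hT
  have memT : ∀ x i e, (⟨x, i, e⟩ : (_ : B) × (_ : ℕ) × ℕ) ∈ T ↔
      x ∈ s ∧ i ≠ 0 ∧ (γ ((φ x).coeff i)).coeff e ≠ 0 := by
    intro x i e
    simp only [hT, Finset.mem_sigma, Finset.mem_erase, mem_support_iff]
    constructor
    · tauto
    · rintro ⟨h1, h2, h3⟩
      refine ⟨h1, ⟨h2, fun h => ?_⟩, h3⟩
      simp [h] at h3
  have hTne : T.Nonempty := by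
    by_contra hempty
    rw [Finset.not_nonempty_iff_eq_empty] at hempty
    apply hne
    have hC : φ = (IsScalarTower.toAlgHom k B B[X]) := by
      refine AlgHom.ext_of_adjoin_eq_top hs fun x hx => ?_
      change φ x = C x
      ext i
      rcases eq_or_ne i 0 with rfl | hi
      · rw [hφ.coeff_zero, coeff_C_zero]
      · rw [coeff_C, if_neg hi]
        refine hγ.eq_zero_of_homPart fun e => ?_
        rw [homPart_natCast]
        by_contra h
        have := (memT x i e).mpr ⟨hx, hi, h⟩
        simp [hempty] at this
    ext x
    simp only [Set.mem_univ, iff_true]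
    change φ x = C x
    rw [hC]
    rfl
  -- The slope `P / q` is the largest rate at which a coefficient of `φ` raises degrees.
  obtain ⟨⟨x₀, q, e₀⟩, h₀, hmax⟩ :=
    T.exists_max_image (fun p => ((p.2.2 : ℚ) - w p.1) / p.2.1) hTne
  rw [memT] at h₀
  obtain ⟨hx₀, hq0, hne₀⟩ := h₀
  have hq : 0 < q := Nat.pos_of_ne_zero hq0
  set P : ℤ := e₀ - w x₀ with hP
  set γ' := ((Polynomial.expand B q).restrictScalars k).comp γ with hγ'
  have hγ'g : IsGrading γ' := hγ.expand hq
  have hw' : ∀ x ∈ s, γ' x = monomial (w x * q) x := by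
    intro x hx
    simp [hγ', hw x hx, expand_monomial]
  have hbound : ∀ x ∈ s, ∀ (i : ℕ) (e : ℤ), ((w x * q : ℕ) : ℤ) + i * P < e →
      homPart γ' e ((φ x).coeff i) = 0 := by
    intro x hx i e he
    rcases eq_or_ne i 0 with rfl | hi
    · rw [hφ.coeff_zero, homPart_of_map_eq (hw' x hx), if_neg]
      rintro rfl
      simp at he
    rcases lt_or_ge e 0 with hneg | hnn
    · exact homPart_of_neg hneg _
    lift e to ℕ using hnn
    rw [homPart_natCast]
    simp only [hγ', AlgHom.comp_apply, AlgHom.restrictScalars_apply, coeff_expand hq]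
    split_ifs with hdvd
    · obtain ⟨m, rfl⟩ := hdvd
      rw [Nat.mul_div_cancel_left _ hq]
      by_contra hne1
      have h1 := hmax ⟨x, i, m⟩ ((memT x i m).mpr ⟨hx, hi, hne1⟩)
      have hi' : (0 : ℚ) < i := by exact_mod_cast Nat.pos_of_ne_zero hi
      have hq' : (0 : ℚ) < q := by exact_mod_cast hq
      rw [div_le_div_iff₀ hi' hq'] at h1
      have h2 : ((w x * q : ℕ) : ℚ) + i * (e₀ - w x₀) < (q * m : ℕ) := by
        rw [hP] at he
        exact_mod_cast he
      push_cast at h2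
      nlinarith
    · rfl
  obtain ⟨ψ, hψ, hψd⟩ := (degreeBound_of_adjoin_eq_top hγ'g hs (w := fun x => w x * q) hw'
    hbound).exists_homogeneous hγ'g hφ
  refine ⟨q, hq, P, γ', ψ, rfl, hψ, ?_, ?_⟩
  · intro huniv
    have h1 : ψ x₀ = C x₀ := by
      have : x₀ ∈ invariants ψ := huniv ▸ Set.mem_univ _
      exact this
    have h2 : homPart γ' (w x₀ * q : ℕ) x₀ = x₀ := by
      rw [homPart_of_map_eq (hw' x₀ hx₀), if_pos rfl]
    have h3 := congrArg (fun F => F.coeff q) (hψd (w x₀ * q : ℕ) x₀)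
    simp only [h2, h1, coeff_levelPart, coeff_C, if_neg hq0] at h3
    have h4 : ((w x₀ * q : ℕ) : ℤ) + q * P = (q * e₀ : ℕ) := by
      rw [hP]; push_cast; ring
    rw [h4, homPart_natCast] at h3
    simp only [hγ', AlgHom.comp_apply, AlgHom.restrictScalars_apply, coeff_expand hq] at h3
    rw [if_pos (dvd_mul_right _ _), Nat.mul_div_cancel_left _ hq] at h3
    exact hne₀ h3.symm
  · intro d b i
    change ((lcoeff B i).restrictScalars k ∘ₗ ψ.toLinearMap ∘ₗ homPart γ' d) b =
      (homPart γ' (d + i * P) ∘ₗ (lcoeff B i).restrictScalars k ∘ₗ ψ.toLinearMap) b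
    congr 1
    refine hγ'g.linearMap_ext fun n b => ?_
    simp only [LinearMap.comp_apply, LinearMap.restrictScalars_apply, lcoeff_apply,
      AlgHom.toLinearMap_apply, hγ'g.homPart_homPart, hψd, coeff_levelPart]
    by_cases h : d = n
    · subst h
      simp [hψd, coeff_levelPart]
    · rw [if_neg h, if_neg (by omega)]
      simp

end Grading

/-! ### Root multiplicities over an algebraically closed field -/

section PolynomialEquations

variable {L : Type*} [Field L]

theorem exists_eq_expChar_pow_mul (L : Type*) [Field L] (q : ℕ) [ExpChar L q] {n : ℕ} (hn : n ≠ 0) :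
    ∃ e m : ℕ, n = q ^ e * m ∧ (m : L) ≠ 0 := by
  rcases ‹ExpChar L q› with _ | hq
  · exact ⟨0, n, by simp, Nat.cast_ne_zero.mpr hn⟩
  · obtain ⟨e, m, hm, h⟩ := Nat.exists_eq_pow_mul_and_not_dvd hn q hq.ne_one
    exact ⟨e, m, h, fun h0 => hm ((CharP.cast_eq_zero_iff L q m).mp h0)⟩

theorem natDegree_C_mul_add_C {c d : L} {v : L[X]} (h : (C c * v + C d).natDegree = 1) :
    v.natDegree = 1 := by
  rw [natDegree_add_C] at h
  rcases eq_or_ne c 0 with rfl | hc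
  · simp at h
  · rwa [natDegree_C_mul hc] at h

/-- Two linear forms in `u` and `v`, one of them constant and the other of degree one. -/
theorem natDegree_eq_one_of_linear {α β α' β' μ : L} {u v : L[X]} (hα : α ≠ 0)
    (h : C α * u + C β * v = C μ) (h1 : (C α' * u + C β' * v).natDegree = 1) :
    v.natDegree = 1 := by
  refine natDegree_C_mul_add_C (c := α * β' - α' * β) (d := α' * μ) ?_
  rw [← h1, ← natDegree_C_mul (p := C α' * u + C β' * v) hα]
  congr 1
  simp only [C_sub, C_mul, ← h]
  ring

theorem natDegree_eq_of_linear {α β μ : L} {u v : L[X]} (hα : α ≠ 0) (hβ : β ≠ 0)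
    (h : C α * u + C β * v = C μ) : u.natDegree = v.natDegree := by
  have h1 : C α * u = C (-β) * v + C μ := by rw [← h, C_neg]; ring
  rw [← natDegree_C_mul hα, h1, natDegree_add_C, natDegree_C_mul (neg_ne_zero.mpr hβ)]

theorem eq_one_of_natDegree_pow {z : L[X]} {n : ℕ} (h : (z ^ n).natDegree = 1) :
    n = 1 ∧ z.natDegree = 1 := by
  rw [natDegree_pow] at h
  exact ⟨Nat.eq_one_of_mul_eq_one_right h, Nat.eq_one_of_mul_eq_one_left h⟩

theorem dvd_rootMultiplicity_pow (x : L[X]) (a : ℕ) (t : L) :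
    a ∣ (x ^ a).rootMultiplicity t := by
  classical
  rw [← count_roots, roots_pow, Multiset.count_nsmul]
  exact dvd_mul_right _ _

/-- The polynomial `(l * w + μ) ^ m + w ^ m` in `w` has only simple roots. -/
theorem derivative_eval_ne_zero {m : ℕ} (hm : (m : L) ≠ 0) (hm2 : 2 ≤ m) {l μ : L}
    (hμ : μ ≠ 0) (w : L) (hw : ((C l * X + C μ) ^ m + X ^ m : L[X]).eval w = 0) :
    (derivative ((C l * X + C μ) ^ m + X ^ m : L[X])).eval w ≠ 0 := by
  intro hd
  obtain ⟨j, rfl⟩ : ∃ j, m = j + 1 := ⟨m - 1, by omega⟩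
  have hj : j ≠ 0 := by omega
  simp only [eval_add, eval_pow, eval_mul, eval_C, eval_X, derivative_add, derivative_pow,
    derivative_mul, derivative_C, derivative_X, Nat.add_sub_cancel, zero_mul, zero_add, mul_one,
    add_zero] at hw hd
  have hd' : ((j + 1 : ℕ) : L) * ((l * w + μ) ^ j * l + w ^ j) = 0 := by
    rw [← hd]; ring
  have h1 := (mul_eq_zero.mp hd').resolve_left hm
  have h2 : (l * w + μ) ^ j * μ = 0 := by
    linear_combination hw - w * h1
  have h3 : l * w + μ = 0 := eq_zero_of_pow_eq_zero ((mul_eq_zero.mp h2).resolve_right hμ)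
  rw [h3, zero_pow hj, zero_mul, zero_add] at h1
  rw [eq_zero_of_pow_eq_zero h1, mul_zero, zero_add] at h3
  exact hμ h3

theorem le_natDegree_linear_pow_add {m : ℕ} (hm : (m : L) ≠ 0) {l μ : L} (hl : l ≠ 0)
    (hμ : μ ≠ 0) : m - 1 ≤ ((C l * X + C μ) ^ m + X ^ m : L[X]).natDegree := by
  have hm0 : m ≠ 0 := by rintro rfl; simp at hm
  apply le_natDegree_of_ne_zero
  have h1 : (C l * X + C μ : L[X]) = C l * (X + C (μ / l)) := by
    rw [mul_add, ← C_mul, mul_div_cancel₀ _ hl]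
  rw [coeff_add, coeff_X_pow, if_neg (by omega), add_zero, h1, mul_pow, ← C_pow, coeff_C_mul,
    coeff_X_add_C_pow, show m - (m - 1) = 1 by omega, pow_one,
    Nat.choose_symm_of_eq_add (show m = (m - 1) + 1 by omega), Nat.choose_one_right]
  exact mul_ne_zero (pow_ne_zero _ hl) (mul_ne_zero (div_ne_zero hμ hl) hm)

/-- For `m` prime to the characteristic exponent, this separates `(l * v + μ) ^ n + v ^ n`, with
`n = q ^ s * m`, into a Frobenius power and a separable polynomial in `v`. -/
theorem pow_add_pow_eq_comp (q : ℕ) [ExpChar L q] (l μ : L) (v : L[X]) (s m : ℕ) :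
    (C l * v + C μ) ^ (q ^ s * m) + v ^ (q ^ s * m) =
      (((C l * X + C μ) ^ m + X ^ m : L[X]).comp v) ^ q ^ s := by
  simp only [add_comp, mul_comp, pow_comp, C_comp, X_comp]
  rw [add_pow_expChar_pow (R := L[X]), ← pow_mul, ← pow_mul, mul_comm m]

variable [IsAlgClosed L]

/-- A separable polynomial of degree at least two has two different roots. -/
theorem exists_two_roots {f : L[X]} (hf : 2 ≤ f.natDegree)
    (hsep : ∀ w, f.eval w = 0 → f.derivative.eval w ≠ 0) :
    ∃ w₀ w₁, w₀ ≠ w₁ ∧ f.eval w₀ = 0 ∧ f.eval w₁ = 0 := by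
  have hdeg : ∀ {p : L[X]}, 1 ≤ p.natDegree → ∃ w, p.eval w = 0 := by
    intro p hp
    refine IsAlgClosed.exists_root p fun h => ?_
    have h0 : p.natDegree = 0 := natDegree_eq_of_degree_eq_some (by simpa using h)
    omega
  obtain ⟨w₀, h₀⟩ := hdeg (le_trans one_le_two hf)
  obtain ⟨Q, hQ⟩ := dvd_iff_isRoot.mpr h₀
  have hQ0 : Q ≠ 0 := by
    rintro rfl
    simp [hQ] at hf
  have hQd : 1 ≤ Q.natDegree := by
    rw [hQ, natDegree_mul (X_sub_C_ne_zero _) hQ0, natDegree_X_sub_C] at hf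
    omega
  obtain ⟨w₁, h₁⟩ := hdeg hQd
  refine ⟨w₀, w₁, ?_, h₀, by simp [hQ, h₁]⟩
  rintro rfl
  exact hsep w₀ h₀ (by simp [hQ, h₁])

theorem exists_eval_eq {z : L[X]} (hz : 1 ≤ z.natDegree) (v : L) : ∃ t, z.eval t = v := by
  obtain ⟨t, ht⟩ := IsAlgClosed.exists_root (z - C v) fun h => by
    have h0 : (z - C v).natDegree = 0 := natDegree_eq_of_degree_eq_some (by simpa using h)
    rw [natDegree_sub_C] at h0
    omega
  exact ⟨t, by simpa [sub_eq_zero] using ht⟩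

variable (q : ℕ) [ExpChar L q]

/-- If `z` has degree one and `n` is `q ^ e` times an integer which is invertible in `L`, then
`z ^ n` takes every non-zero value somewhere with multiplicity `q ^ e`. -/
theorem exists_rootMultiplicity_pow_sub_C {z : L[X]} (hz : z.natDegree = 1) {w : L} (hw : w ≠ 0)
    {n e m : ℕ} (hn : n = q ^ e * m) (hm : (m : L) ≠ 0) :
    ∃ t, (z ^ n).eval t = w ∧ (z ^ n - C w).rootMultiplicity t = q ^ e := by
  classical
  have hq : 0 < q ^ e := pow_pos (expChar_pos L q) e
  have hm0 : m ≠ 0 := by rintro rfl; simp at hm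
  have hn0 : 0 < n := hn ▸ Nat.mul_pos hq (Nat.pos_of_ne_zero hm0)
  obtain ⟨v, hv⟩ := IsAlgClosed.exists_pow_nat_eq w hn0
  have hv0 : v ≠ 0 := by
    rintro rfl
    rw [zero_pow hn0.ne'] at hv
    exact hw hv.symm
  obtain ⟨t, ht⟩ := exists_eval_eq hz.ge v
  refine ⟨t, by rw [eval_pow, ht, hv], ?_⟩
  have hfac : z ^ n - C w = (z ^ m - C (v ^ m)) ^ q ^ e := by
    rw [sub_pow_expChar_pow, ← C_pow, ← pow_mul, ← pow_mul, mul_comm m, ← hn, hv]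
  have hderiv : (derivative (z ^ m - C (v ^ m))).eval t ≠ 0 := by
    have hz' : derivative z = C z.leadingCoeff := by
      rw [leadingCoeff, hz]
      conv_lhs => rw [eq_X_add_C_of_natDegree_le_one hz.le]
      simp
    rw [derivative_sub, derivative_C, sub_zero, derivative_pow, hz']
    simp only [eval_mul, eval_C, eval_pow, ht]
    refine mul_ne_zero (mul_ne_zero hm (pow_ne_zero _ hv0)) (leadingCoeff_ne_zero.mpr ?_)
    rintro rfl
    simp at hz
  have hne : z ^ m - C (v ^ m) ≠ 0 := by
    intro h
    rw [h, derivative_zero, eval_zero] at hderiv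
    exact hderiv rfl
  have hroot : IsRoot (z ^ m - C (v ^ m)) t := by simp [ht]
  have h1 : (z ^ m - C (v ^ m)).rootMultiplicity t = 1 := by
    have h2 := (rootMultiplicity_pos hne).mpr hroot
    have h3 : ¬ 1 < (z ^ m - C (v ^ m)).rootMultiplicity t := fun h =>
      hderiv ((one_lt_rootMultiplicity_iff_isRoot hne).mp h).2
    omega
  rw [hfac, ← count_roots, roots_pow, Multiset.count_nsmul, count_roots, h1, mul_one]

/-- If the curve `α y ^ m + β z ^ n = μ` is parametrised by polynomials with `z` of degree one, then
`m` divides a power of the characteristic exponent that divides `n`. -/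
theorem exists_dvd_expChar_pow {y z : L[X]} {α β μ : L} (hα : α ≠ 0) (hβ : β ≠ 0) (hμ : μ ≠ 0)
    {m n : ℕ} (hn : n ≠ 0) (hz : z.natDegree = 1) (h : C α * y ^ m + C β * z ^ n = C μ) :
    ∃ e, m ∣ q ^ e ∧ q ^ e ∣ n := by
  classical
  obtain ⟨e, n', hn', hn0⟩ := exists_eq_expChar_pow_mul L q hn
  obtain ⟨t, -, ht⟩ :=
    exists_rootMultiplicity_pow_sub_C q hz (div_ne_zero hμ hβ) hn' hn0
  refine ⟨e, ?_, hn' ▸ dvd_mul_right _ _⟩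
  have h1 : z ^ n - C (μ / β) = C (-α / β) * y ^ m := by
    have hββ : (C β : L[X]) * C β⁻¹ = 1 := by rw [← C_mul, mul_inv_cancel₀ hβ, C_1]
    rw [div_eq_mul_inv, div_eq_mul_inv, C_mul, C_mul, ← h, C_neg]
    linear_combination -(z ^ n) * hββ
  rw [← ht, h1, ← count_roots, roots_C_mul _ (div_ne_zero (neg_ne_zero.mpr hα) hβ), count_roots]
  exact dvd_rootMultiplicity_pow y m t

/-- Suppose that `x ^ a + y ^ g + z ^ (c' * g) = 0` with `y = l * z ^ c' + μ` and `z` of degree one.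
At a point where `z ^ c'` takes the value of a simple root of `(l * w + μ) ^ m + w ^ m`, the
multiplicity of `x ^ a` is a power of the characteristic exponent that divides `c' * g`. -/
theorem exists_dvd_expChar_pow_of_linear {x z : L[X]} {l μ : L} (hl : l ≠ 0) (hμ : μ ≠ 0)
    {a c' g s m : ℕ} (hc : c' ≠ 0) (hg : g = q ^ s * m) (hm : (m : L) ≠ 0) (hm2 : 2 ≤ m)
    (hz : z.natDegree = 1) (h : x ^ a + (C l * z ^ c' + C μ) ^ g + (z ^ c') ^ g = 0) :
    ∃ e, a ∣ q ^ e ∧ q ^ e ∣ c' * g := by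
  classical
  set F : L[X] := (C l * X + C μ) ^ m + X ^ m with hF
  have hFd : m - 1 ≤ F.natDegree := le_natDegree_linear_pow_add hm hl hμ
  obtain ⟨w, hw⟩ := exists_eval_eq (z := F) (by omega) 0
  have hw' := derivative_eval_ne_zero hm hm2 hμ w hw
  have hw0 : w ≠ 0 := by
    rintro rfl
    simp [hF, hμ, show m ≠ 0 by omega] at hw
  obtain ⟨e, n, hn, hn0⟩ := exists_eq_expChar_pow_mul L q hc
  obtain ⟨t, ht, hmult⟩ := exists_rootMultiplicity_pow_sub_C q hz hw0 hn hn0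
  obtain ⟨H, hH⟩ := dvd_iff_isRoot.mpr hw
  have hHw : H.eval w ≠ 0 := by
    intro h0
    apply hw'
    rw [← hF, hH]
    simp [h0]
  have hHt : ¬ IsRoot (H.comp (z ^ c')) t := by rwa [IsRoot, eval_comp, ht]
  have hx : x ^ a = -((z ^ c' - C w) * H.comp (z ^ c')) ^ q ^ s := by
    have h1 := pow_add_pow_eq_comp q l μ (z ^ c') s m
    rw [← hg, ← hF, hH, mul_comp, sub_comp, X_comp, C_comp] at h1
    linear_combination h - h1
  have hmult' : (x ^ a).rootMultiplicity t = q ^ s * q ^ e := by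
    have hne1 : z ^ c' - C w ≠ 0 := by
      intro h0
      rw [h0, rootMultiplicity_zero] at hmult
      exact (pow_pos (expChar_pos L q) e).ne hmult
    have hne2 : H.comp (z ^ c') ≠ 0 := by
      intro h0
      simp [h0] at hHt
    rw [hx, ← count_roots, roots_neg, roots_pow, Multiset.count_nsmul, count_roots,
      rootMultiplicity_mul (mul_ne_zero hne1 hne2), hmult, rootMultiplicity_eq_zero hHt, add_zero]
  refine ⟨s + e, ?_, ?_⟩
  · rw [pow_add, ← hmult']
    exact dvd_rootMultiplicity_pow x a t
  · rw [pow_add, mul_comm c', hg, hn]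
    exact mul_dvd_mul (dvd_mul_right _ _) (dvd_mul_right _ _)

/-- If `u ^ m + v ^ m` is a non-zero constant and `m ≥ 2` is invertible in `L`, then `v` is
constant: at least two of the linear factors of `u ^ m + v ^ m` are units. -/
theorem natDegree_eq_zero_of_pow_add_pow {m : ℕ} (hm : (m : L) ≠ 0) (hm2 : 2 ≤ m) {u v : L[X]}
    (h : IsUnit (u ^ m + v ^ m)) : v.natDegree = 0 := by
  obtain ⟨w₀, w₁, hne, h₀, h₁⟩ := exists_two_roots (f := (X ^ m + C 1 : L[X]))
    (by rwa [natDegree_X_pow_add_C]) fun w hw => by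
      have hw0 : w ≠ 0 := by
        rintro rfl
        simp [show m ≠ 0 by omega] at hw
      simp [derivative_X_pow, hm, hw0]
  have key : ∀ w : L, (X ^ m + C 1 : L[X]).eval w = 0 → (u - C w * v).natDegree = 0 := by
    intro w hw
    have hw' : w ^ m = -1 := by
      simp only [eval_add, eval_pow, eval_X, eval_C] at hw
      exact eq_neg_of_add_eq_zero_left hw
    refine natDegree_eq_zero_of_isUnit (isUnit_of_dvd_unit ?_ h)
    have := sub_dvd_pow_sub_pow u (C w * v) m
    rwa [mul_pow, ← C_pow, hw', C_neg, C_1, neg_one_mul, sub_neg_eq_add] at this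
  have h2 : C (w₁ - w₀) * v = (u - C w₀ * v) - (u - C w₁ * v) := by
    rw [C_sub]; ring
  rw [← natDegree_C_mul (sub_ne_zero.mpr hne.symm), h2, ← Nat.le_zero]
  exact (natDegree_sub_le _ _).trans (by rw [key _ h₀, key _ h₁]; simp)

end PolynomialEquations

/-! ### Polynomial parametrisations of `x ^ a + y ^ b + z ^ c = 0` -/

section PolynomialSolutions

variable {L : Type*} [Field L]

/-- The building blocks of homogeneous elements: `x`, `y`, `z` and the linear forms in `y ^ b'` and
`z ^ c'`. -/
def IsBasicFactor (b' c' : ℕ) (x y z f : L[X]) : Prop :=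
  f = x ∨ f = y ∨ f = z ∨ ∃ α β : L, f = C α * y ^ b' + C β * z ^ c'

theorem IsBasicFactor.swap {b' c' : ℕ} {x y z f : L[X]} (h : IsBasicFactor b' c' x y z f) :
    IsBasicFactor c' b' x z y f := by
  rcases h with h | h | h | ⟨α, β, h⟩
  · exact .inl h
  · exact .inr (.inr (.inl h))
  · exact .inr (.inl h)
  · exact .inr (.inr (.inr ⟨β, α, by rw [h, add_comm]⟩))

variable [IsAlgClosed L] (q : ℕ) [ExpChar L q]

/-- The case of a constant `x`. -/
theorem false_of_left_const {b c b' c' g : ℕ} (hb : b = b' * g) (hc : c = c' * g) (hb0 : b ≠ 0)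
    (hc0 : c ≠ 0) (hRb : ∀ e, b ∣ q ^ e → ¬ q ^ e ∣ c) (hRc : ∀ e, c ∣ q ^ e → ¬ q ^ e ∣ b)
    {x y z f : L[X]} {κ : L} (hκ : κ ≠ 0) (h : y ^ b + z ^ c = C κ) (hx : x.natDegree = 0)
    (hf : IsBasicFactor b' c' x y z f) (hf1 : f.natDegree = 1) : False := by
  have caseY : y.natDegree = 1 → False := fun hy => by
    obtain ⟨e, h1, h2⟩ := exists_dvd_expChar_pow q (one_ne_zero (α := L)) one_ne_zero hκ hb0 hy
      (m := c) (y := z) (by rw [← h, C_1]; ring)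
    exact hRc e h1 h2
  have caseZ : z.natDegree = 1 → False := fun hz => by
    obtain ⟨e, h1, h2⟩ := exists_dvd_expChar_pow q (one_ne_zero (α := L)) one_ne_zero hκ hc0 hz
      (m := b) (y := y) (by rw [← h, C_1]; ring)
    exact hRb e h1 h2
  rcases hf with rfl | rfl | rfl | ⟨α, β, rfl⟩
  · omega
  · exact caseY hf1
  · exact caseZ hf1
  · have hg0 : g ≠ 0 := by rintro rfl; simp at hb; exact hb0 hb
    obtain ⟨s, m, hg, hm⟩ := exists_eq_expChar_pow_mul L q hg0
    have hm0 : m ≠ 0 := by rintro rfl; simp at hm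
    have hpow : ((y ^ b') ^ m + (z ^ c') ^ m) ^ q ^ s = C κ := by
      rw [add_pow_expChar_pow, ← h, hb, hc, hg]
      simp only [← pow_mul]
      congr 2 <;> ring
    have hunit : IsUnit ((y ^ b') ^ m + (z ^ c') ^ m) := by
      refine isUnit_of_dvd_unit (dvd_pow_self _ (pow_pos (expChar_pos L q) s).ne') ?_
      rw [hpow]
      exact isUnit_C.mpr hκ.isUnit
    rcases Nat.lt_or_ge m 2 with hm2 | hm2
    · obtain rfl : m = 1 := by omega
      rw [pow_one, pow_one] at hunit
      obtain ⟨κ', -, h'⟩ := Polynomial.isUnit_iff.mp hunit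
      refine caseZ (eq_one_of_natDegree_pow (n := c') ?_).2
      exact natDegree_eq_one_of_linear (one_ne_zero (α := L)) (β := 1) (μ := κ')
        (by rw [h', C_1]; ring) hf1
    · have hv := natDegree_eq_zero_of_pow_add_pow hm hm2 hunit
      rw [add_comm] at hunit
      have hu := natDegree_eq_zero_of_pow_add_pow hm hm2 hunit
      have : (C α * y ^ b' + C β * z ^ c').natDegree ≤ 0 :=
        natDegree_add_le_of_degree_le ((natDegree_C_mul_le _ _).trans hu.le)
          ((natDegree_C_mul_le _ _).trans hv.le)
      omega

/-- The case of a constant `y`; the case of a constant `z` follows by symmetry. -/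
theorem false_of_middle_const {a c b' c' : ℕ} (ha0 : a ≠ 0) (hc0 : c ≠ 0)
    (ha1 : a ≠ 1) (hc1 : c ≠ 1) (hac : a.Coprime c)
    {x y z f : L[X]} {κ : L} (hκ : κ ≠ 0) (h : x ^ a + z ^ c = C κ) (hy : y.natDegree = 0)
    (hf : IsBasicFactor b' c' x y z f) (hf1 : f.natDegree = 1) : False := by
  obtain ⟨q, _⟩ := ExpChar.exists L
  have caseX : x.natDegree = 1 → False := fun hx => by
    obtain ⟨e, h1, h2⟩ := exists_dvd_expChar_pow q (one_ne_zero (α := L)) one_ne_zero hκ ha0 hx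
      (m := c) (y := z) (by rw [← h, C_1]; ring)
    exact hc1 (Nat.eq_one_of_dvd_coprimes hac (h1.trans h2) dvd_rfl)
  have caseZ : z.natDegree = 1 → False := fun hz => by
    obtain ⟨e, h1, h2⟩ := exists_dvd_expChar_pow q (one_ne_zero (α := L)) one_ne_zero hκ hc0 hz
      (m := a) (y := x) (by rw [← h, C_1]; ring)
    exact ha1 (Nat.eq_one_of_dvd_coprimes hac dvd_rfl (h1.trans h2))
  rcases hf with rfl | rfl | rfl | ⟨α, β, rfl⟩
  · exact caseX hf1
  · omega
  · exact caseZ hf1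
  · refine caseZ (eq_one_of_natDegree_pow (n := c') (natDegree_C_mul_add_C (c := β)
      (d := α * y.coeff 0 ^ b') ?_)).2
    rw [← hf1, add_comm]
    conv_rhs => rw [eq_C_of_natDegree_eq_zero hy]
    simp

/-- The case of a linear form `α y ^ b' + β z ^ c' = μ` and `z` of degree one. -/
theorem false_of_linear_const_right {a b c b' c' g : ℕ} (hb : b = b' * g) (hc : c = c' * g)
    (hbc' : b'.Coprime c') (hac : a.Coprime c) (ha1 : a ≠ 1) (hb0 : b ≠ 0) (hc0 : c ≠ 0)
    (hRb : ∀ e, b ∣ q ^ e → ¬ q ^ e ∣ c)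
    {x y z : L[X]} {α β μ : L} (hα : α ≠ 0) (hβ : β ≠ 0) (hμ : μ ≠ 0)
    (h : x ^ a + y ^ b + z ^ c = 0) (hlin : C α * y ^ b' + C β * z ^ c' = C μ)
    (hz : z.natDegree = 1) : False := by
  have hc'0 : c' ≠ 0 := by rintro rfl; simp at hc; exact hc0 hc
  have hg0 : g ≠ 0 := by rintro rfl; simp at hb; exact hb0 hb
  obtain ⟨e, h1, h2⟩ := exists_dvd_expChar_pow q hα hβ hμ hc'0 hz hlin
  obtain rfl : b' = 1 := Nat.eq_one_of_dvd_coprimes hbc' dvd_rfl (h1.trans h2)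
  rw [one_mul] at hb
  subst hb
  obtain ⟨s, m, hg, hm⟩ := exists_eq_expChar_pow_mul L q hg0
  have hm0 : m ≠ 0 := by rintro rfl; simp at hm
  have hm2 : 2 ≤ m := by
    by_contra hlt
    obtain rfl : m = 1 := by omega
    rw [mul_one] at hg
    exact hRb s (hg ▸ dvd_rfl) (by rw [hc, ← hg]; exact dvd_mul_left _ _)
  have hy : y = C (-β / α) * z ^ c' + C (μ / α) := by
    have hαα : (C α : L[X]) * C α⁻¹ = 1 := by rw [← C_mul, mul_inv_cancel₀ hα, C_1]
    rw [div_eq_mul_inv, div_eq_mul_inv, C_mul, C_mul, ← hlin, C_neg]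
    linear_combination -y * hαα
  obtain ⟨e', h3, h4⟩ := exists_dvd_expChar_pow_of_linear q
    (div_ne_zero (neg_ne_zero.mpr hβ) hα) (div_ne_zero hμ hα) hc'0 hg hm hm2 hz
    (a := a) (x := x) (by rw [← hy, ← pow_mul, ← hc, h])
  rw [← hc] at h4
  exact ha1 (Nat.eq_one_of_dvd_coprimes hac dvd_rfl (h3.trans h4))

/-- The case of a linear form `α y ^ b' + β z ^ c' = μ` and `x` of degree one: comparing degrees
gives `b' = c' = 1`, and then `x` would have two different zeros. -/
theorem false_of_linear_const_left {a b c b' c' g : ℕ} (hb : b = b' * g) (hc : c = c' * g)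
    (hbc' : b'.Coprime c') (hab : a.Coprime b) (hac : a.Coprime c) (ha0 : a ≠ 0) (hb0 : b ≠ 0)
    (hb1 : b ≠ 1) (hT : ¬ (b = 2 ∧ c = 2))
    {x y z : L[X]} {α β μ : L} (hα : α ≠ 0) (hβ : β ≠ 0) (hμ : μ ≠ 0)
    (h : x ^ a + y ^ b + z ^ c = 0) (hlin : C α * y ^ b' + C β * z ^ c' = C μ)
    (hx : x.natDegree = 1) : False := by
  obtain ⟨q, _⟩ := ExpChar.exists L
  have hg0 : g ≠ 0 := by rintro rfl; simp at hb; exact hb0 hb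
  obtain ⟨s, m, hg, hm⟩ := exists_eq_expChar_pow_mul L q hg0
  set l := -β / α
  set ν := μ / α
  have hl : l ≠ 0 := div_ne_zero (neg_ne_zero.mpr hβ) hα
  have hν : ν ≠ 0 := div_ne_zero hμ hα
  have hy : y ^ b' = C l * z ^ c' + C ν := by
    have hαα : (C α : L[X]) * C α⁻¹ = 1 := by rw [← C_mul, mul_inv_cancel₀ hα, C_1]
    simp only [l, ν]
    rw [div_eq_mul_inv, div_eq_mul_inv, C_mul, C_mul, ← hlin, C_neg]
    linear_combination -y ^ b' * hαα
  set F : L[X] := (C l * X + C ν) ^ m + X ^ m with hF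
  have hFd : m - 1 ≤ F.natDegree := le_natDegree_linear_pow_add hm hl hν
  have hxF : x ^ a = -(F.comp (z ^ c')) ^ q ^ s := by
    have h1 := pow_add_pow_eq_comp q l ν (z ^ c') s m
    rw [← hg, ← hF, ← hy, ← pow_mul, ← pow_mul, ← hb, ← hc] at h1
    linear_combination h - h1
  have hdeg : a = q ^ s * (F.natDegree * (z ^ c').natDegree) := by
    have := congrArg natDegree hxF
    rwa [natDegree_neg, natDegree_pow, natDegree_pow, natDegree_comp, hx, mul_one] at this
  have hdz : (z ^ c').natDegree ∣ a := hdeg ▸ dvd_mul_of_dvd_right (dvd_mul_left _ _) _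
  have hc'1 : c' = 1 := by
    refine Nat.eq_one_of_dvd_coprimes hac ?_ (hc ▸ dvd_mul_right _ _)
    exact (natDegree_pow z c' ▸ dvd_mul_right _ _ : c' ∣ (z ^ c').natDegree).trans hdz
  have hb'1 : b' = 1 := by
    refine Nat.eq_one_of_dvd_coprimes hab ?_ (hb ▸ dvd_mul_right _ _)
    rw [← natDegree_eq_of_linear hα hβ hlin] at hdz
    exact (natDegree_pow y b' ▸ dvd_mul_right _ _ : b' ∣ (y ^ b').natDegree).trans hdz
  have hs1 : q ^ s = 1 := by
    refine Nat.eq_one_of_dvd_coprimes hac (hdeg ▸ dvd_mul_right _ _) ?_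
    rw [hc, hg]
    exact dvd_mul_of_dvd_right (dvd_mul_right _ _) _
  subst hc'1 hb'1
  rw [hs1, one_mul] at hg
  have hm3 : 3 ≤ m := by omega
  obtain ⟨w₀, w₁, hne, h₀, h₁⟩ := exists_two_roots (f := F) (by omega) fun w hw =>
    derivative_eval_ne_zero hm (by omega) hν w hw
  have hz1 : 1 ≤ z.natDegree := by
    rw [pow_one] at hdeg
    by_contra h0
    obtain hz0 : z.natDegree = 0 := by omega
    rw [hz0, mul_zero, mul_zero] at hdeg
    exact ha0 hdeg
  have hroot : ∀ w, F.eval w = 0 → ∃ t, z.eval t = w ∧ x.eval t = 0 := by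
    intro w hw
    obtain ⟨t, ht⟩ := exists_eval_eq hz1 w
    refine ⟨t, ht, ?_⟩
    have := congrArg (eval t) hxF
    rw [hs1, pow_one, pow_one, eval_pow, eval_neg, eval_comp, ht, hw, neg_zero] at this
    exact eq_zero_of_pow_eq_zero this
  obtain ⟨t₀, hz₀, hx₀⟩ := hroot w₀ h₀
  obtain ⟨t₁, hz₁, hx₁⟩ := hroot w₁ h₁
  have htt : t₀ ≠ t₁ := by
    rintro rfl
    exact hne (hz₀.symm.trans hz₁)
  have hxl : x.coeff 1 ≠ 0 := by
    rw [← hx]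
    exact leadingCoeff_ne_zero.mpr (by rintro rfl; simp at hx)
  rw [eq_X_add_C_of_natDegree_le_one hx.le] at hx₀ hx₁
  simp only [eval_add, eval_mul, eval_C, eval_X] at hx₀ hx₁
  exact htt (mul_left_cancel₀ hxl (by linear_combination hx₀ - hx₁))

/-- Under the arithmetic conditions on the exponents, a parametrisation of `x ^ a + y ^ b + z ^ c = 0`
by polynomials over an algebraically closed field of characteristic exponent `q` cannot have both a
constant basic factor and a basic factor of degree one. -/
theorem false_of_basicFactors {a b c b' c' g : ℕ} (hb : b = b' * g) (hc : c = c' * g)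
    (hbc' : b'.Coprime c') (hab : a.Coprime b) (hac : a.Coprime c) (ha : 2 ≤ a) (hb2 : 2 ≤ b)
    (hc2 : 2 ≤ c) (hT : ¬ (b = 2 ∧ c = 2))
    (hRb : ∀ e, b ∣ q ^ e → ¬ q ^ e ∣ c) (hRc : ∀ e, c ∣ q ^ e → ¬ q ^ e ∣ b)
    {x y z f₀ f₁ : L[X]} (hx0 : x ≠ 0) (hy0 : y ≠ 0) (hz0 : z ≠ 0) (h : x ^ a + y ^ b + z ^ c = 0)
    (hf₀ : IsBasicFactor b' c' x y z f₀) (hf₀d : f₀.natDegree = 0) (hf₀0 : f₀ ≠ 0)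
    (hf₁ : IsBasicFactor b' c' x y z f₁) (hf₁d : f₁.natDegree = 1) : False := by
  have hb'0 : b' ≠ 0 := by rintro rfl; omega
  have hc'0 : c' ≠ 0 := by rintro rfl; omega
  have const : ∀ {p : L[X]} {n : ℕ}, p ≠ 0 → p.natDegree = 0 →
      ∃ κ : L, κ ≠ 0 ∧ C κ = -p ^ n := by
    intro p n hp hpd
    refine ⟨-(p.coeff 0) ^ n, neg_ne_zero.mpr (pow_ne_zero _ fun h0 => hp ?_), ?_⟩
    · rw [eq_C_of_natDegree_eq_zero hpd, h0, C_0]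
    · rw [C_neg, C_pow, ← eq_C_of_natDegree_eq_zero hpd]
  have caseY : y.natDegree = 0 → False := fun hyd => by
    obtain ⟨κ, hκ, hκ'⟩ := const (n := b) hy0 hyd
    exact false_of_middle_const (by omega) (by omega) (by omega) (by omega) hac hκ
      (by rw [hκ']; linear_combination h) hyd hf₁ hf₁d
  have caseZ : z.natDegree = 0 → False := fun hzd => by
    obtain ⟨κ, hκ, hκ'⟩ := const (n := c) hz0 hzd
    exact false_of_middle_const (by omega) (by omega) (by omega) (by omega) hab hκ
      (by rw [hκ']; linear_combination h) hzd hf₁.swap hf₁d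
  have zero_of_pow : ∀ {p : L[X]} {n : ℕ}, n ≠ 0 → (p ^ n).natDegree = 0 → p.natDegree = 0 := by
    intro p n hn hp
    rw [natDegree_pow] at hp
    exact (Nat.mul_eq_zero.mp hp).resolve_left hn
  rcases hf₀ with rfl | rfl | rfl | ⟨α, β, rfl⟩
  · obtain ⟨κ, hκ, hκ'⟩ := const (n := a) hx0 hf₀d
    exact false_of_left_const q hb hc (by omega) (by omega) hRb hRc hκ
      (by rw [hκ']; linear_combination h) hf₀d hf₁ hf₁d
  · exact caseY hf₀d
  · exact caseZ hf₀d
  · obtain ⟨μ, hμ⟩ : ∃ μ, C α * y ^ b' + C β * z ^ c' = C μ := ⟨_, eq_C_of_natDegree_eq_zero hf₀d⟩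
    have hμ0 : μ ≠ 0 := by
      rintro rfl
      exact hf₀0 (by rw [hμ, C_0])
    rcases eq_or_ne α 0 with rfl | hα
    · refine caseZ (zero_of_pow hc'0 ?_)
      have hβ : β ≠ 0 := by
        rintro rfl
        simp at hf₀0
      rwa [C_0, zero_mul, zero_add, natDegree_C_mul hβ] at hf₀d
    rcases eq_or_ne β 0 with rfl | hβ
    · refine caseY (zero_of_pow hb'0 ?_)
      rwa [C_0, zero_mul, add_zero, natDegree_C_mul hα] at hf₀d
    have caseR : z.natDegree = 1 → False := fun hz1 =>
      false_of_linear_const_right q hb hc hbc' hac (by omega) (by omega) (by omega) hRb hα hβ hμ0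
        h hμ hz1
    have caseL : y.natDegree = 1 → False := fun hy1 =>
      false_of_linear_const_right q hc hb hbc'.symm hab (by omega) (by omega) (by omega) hRc hβ hα
        hμ0 (x := x) (y := z) (by rw [← h]; ring) (by rw [← hμ]; ring) hy1
    rcases hf₁ with rfl | rfl | rfl | ⟨α', β', rfl⟩
    · exact false_of_linear_const_left hb hc hbc' hab hac (by omega) (by omega) (by omega)
        hT hα hβ hμ0 h hμ hf₁d
    · exact caseL hf₁d
    · exact caseR hf₁d
    · exact caseR (eq_one_of_natDegree_pow (natDegree_eq_one_of_linear hα hμ hf₁d)).2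

end PolynomialSolutions

/-! ### Binary forms -/

section BinaryForms

variable {k R : Type*} [CommRing k] [CommRing R] [Algebra k R]

/-- The values at `(u, v)` of the binary forms of degree `M` with coefficients in `k`. -/
noncomputable def binaryForms (k : Type*) {R : Type*} [CommRing k] [CommRing R] [Algebra k R]
    (u v : R) (M : ℕ) : Submodule k R :=
  (degreeLE k M).map ((MvPolynomial.aeval ![u, v]).toLinearMap ∘ₗ homogenizeLM M)

theorem mem_binaryForms {u v : R} {M : ℕ} {f : R} :
    f ∈ binaryForms k u v M ↔
      ∃ p : k[X], p.natDegree ≤ M ∧ MvPolynomial.aeval ![u, v] (p.homogenize M) = f := by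
  simp [binaryForms, Submodule.mem_map, mem_degreeLE, natDegree_le_iff_degree_le]

theorem mul_mem_binaryForms {u v : R} {M N : ℕ} {f h : R} (hf : f ∈ binaryForms k u v M)
    (hh : h ∈ binaryForms k u v N) : f * h ∈ binaryForms k u v (M + N) := by
  rw [mem_binaryForms] at *
  obtain ⟨p, hp, rfl⟩ := hf
  obtain ⟨r, hr, rfl⟩ := hh
  exact ⟨p * r, natDegree_mul_le.trans (add_le_add hp hr), by rw [homogenize_mul _ _ hp hr, map_mul]⟩

theorem one_mem_binaryForms (u v : R) : (1 : R) ∈ binaryForms k u v 0 :=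
  mem_binaryForms.mpr ⟨1, by simp, by simp⟩

theorem pow_mem_binaryForms {u v : R} {M : ℕ} {f : R} (hf : f ∈ binaryForms k u v M) (n : ℕ) :
    f ^ n ∈ binaryForms k u v (M * n) := by
  induction n with
  | zero => simpa using one_mem_binaryForms u v
  | succ n ih => rw [pow_succ, Nat.mul_succ]; exact mul_mem_binaryForms ih hf

theorem left_mem_binaryForms (u v : R) : u ∈ binaryForms k u v 1 :=
  mem_binaryForms.mpr ⟨X, natDegree_X_le, by simp⟩

theorem right_mem_binaryForms (u v : R) : v ∈ binaryForms k u v 1 :=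
  mem_binaryForms.mpr ⟨1, by simp, by simp⟩

theorem aeval_homogenize_mul {p : k[X]} {n : ℕ} (hp : p.natDegree ≤ n) (r s : R) :
    MvPolynomial.aeval ![r * s, r] (p.homogenize n) = r ^ n * aeval s p := by
  refine induction_with_natDegree_le
    (fun p : k[X] => MvPolynomial.aeval ![r * s, r] (p.homogenize n) = r ^ n * aeval s p) n
    ?_ ?_ ?_ p hp
  · simp
  · intro m c _ hm
    rw [homogenize_C_mul, homogenize_X_pow hm]
    obtain ⟨j, rfl⟩ := Nat.exists_eq_add_of_le hm
    simp [mul_pow, pow_add]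
    ring
  · intro f h _ _ hf hh
    simp [hf, hh, mul_add]

/-- Over an algebraically closed field, a binary form is a product of linear forms. -/
theorem exists_eq_prod_linear {L R : Type*} [Field L] [IsAlgClosed L] [CommRing R] [Algebra L R]
    (u v : R) (M : ℕ) (p : L[X]) (hp : p.natDegree ≤ M) :
    ∃ (c : L) (s : Multiset (L × L)), s.card = M ∧
      MvPolynomial.aeval ![u, v] (p.homogenize M) =
        algebraMap L R c * (s.map fun r => r.1 • u + r.2 • v).prod := by
  induction M generalizing p with
  | zero =>
    rw [eq_C_of_natDegree_le_zero hp]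
    exact ⟨p.coeff 0, 0, by simp, by simp⟩
  | succ M ih =>
    rcases Nat.lt_or_ge M p.natDegree with h | h
    · obtain ⟨r, hr⟩ := exists_eval_eq (z := p) (by omega) 0
      obtain ⟨p', rfl⟩ := dvd_iff_isRoot.mpr hr
      have hp0 : p' ≠ 0 := by rintro rfl; simp at h
      rw [natDegree_mul (X_sub_C_ne_zero _) hp0, natDegree_X_sub_C] at hp
      obtain ⟨c, s, hs, h'⟩ := ih p' (by omega)
      refine ⟨c, (1, -r) ::ₘ s, by simp [hs], ?_⟩
      rw [add_comm M 1, homogenize_mul _ _ (natDegree_X_sub_C_le r) (by omega), map_mul, h',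
        Multiset.map_cons, Multiset.prod_cons]
      simp [Algebra.smul_def]
      ring
    · obtain ⟨c, s, hs, h'⟩ := ih p h
      refine ⟨c, (0, 1) ::ₘ s, by simp [hs], ?_⟩
      rw [← mul_one p, homogenize_mul _ _ h (by simp : (1 : L[X]).natDegree ≤ 1), map_mul, h',
        Multiset.map_cons, Multiset.prod_cons]
      simp
      ring

end BinaryForms

/-! ### Gradings of generated and rescaled algebras -/

section Grading

variable {k B : Type*} [CommRing k] [CommRing B] [Algebra k B] {γ : B →ₐ[k] B[X]}

theorem isGrading_of_adjoin_eq_top {s : Set B} (hs : Algebra.adjoin k s = ⊤) (w : B → ℕ)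
    (hw : ∀ x ∈ s, γ x = monomial (w x) x) : IsGrading γ where
  eval_one b := by
    have : (((aeval (1 : B) : B[X] →ₐ[B] B).restrictScalars k).comp γ) = AlgHom.id k B :=
      AlgHom.ext_of_adjoin_eq_top hs fun x hx => by simp [hw x hx]
    simpa [aeval_def, eval₂_eq_eval_map] using DFunLike.congr_fun this b
  map_coeff b := by
    have hb : b ∈ Algebra.adjoin k s := hs ▸ Algebra.mem_top
    induction hb using Algebra.adjoin_induction with
    | mem x hx =>
      intro d
      rw [hw x hx, coeff_monomial]
      split_ifs with h
      · rw [hw x hx, h]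
      · simp
    | algebraMap r =>
      intro d
      rw [AlgHom.commutes, Polynomial.algebraMap_apply, coeff_C]
      split_ifs with h
      · rw [AlgHom.commutes, Polynomial.algebraMap_apply, h, monomial_zero_left]
      · simp
    | add x y _ _ hx hy =>
      intro d
      simp only [map_add, coeff_add, hx d, hy d]
    | mul x y _ _ hx hy =>
      intro d
      rw [map_mul, coeff_mul, map_sum, map_sum]
      refine Finset.sum_congr rfl fun p hp => ?_
      rw [map_mul, hx, hy, monomial_mul_monomial, Finset.HasAntidiagonal.mem_antidiagonal.mp hp]

theorem exists_of_expand_comp_eq_monomial {q : ℕ} (hq : 0 < q) {m : ℕ} {f : B} (hf0 : f ≠ 0)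
    (hf : ((Polynomial.expand B q).restrictScalars k).comp γ f = monomial m f) :
    ∃ e, m = q * e ∧ γ f = monomial e f := by
  have hf' : Polynomial.expand B q (γ f) = monomial m f := hf
  by_cases h : q ∣ m
  · obtain ⟨e, rfl⟩ := h
    refine ⟨e, rfl, expand_injective hq ?_⟩
    rw [hf', expand_monomial, mul_comm]
  · have := congrArg (fun F => F.coeff m) hf'
    simp only [coeff_expand hq, if_neg h, coeff_monomial_same] at this
    exact absurd this.symm hf0

end Grading

/-! ### The rings `k[X, Y, Z] / (X ^ a + Y ^ b + Z ^ c)` -/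

section PBRing

variable {k : Type*} [Field k] {a b c : ℕ}

/-- The image of the `i`-th variable in the Pham-Brieskorn ring. -/
noncomputable def gen (k : Type*) [Field k] (a b c : ℕ) (i : Fin 3) : PBRing k ![a, b, c] :=
  Ideal.Quotient.mk _ (MvPolynomial.X i)

theorem gen_relation : gen k a b c 0 ^ a + gen k a b c 1 ^ b + gen k a b c 2 ^ c = 0 := by
  have e : (∑ i : Fin 3, (MvPolynomial.X i : MvPolynomial (Fin 3) k) ^ ![a, b, c] i) =
      MvPolynomial.X 0 ^ a + MvPolynomial.X 1 ^ b + MvPolynomial.X 2 ^ c := by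
    simp [Fin.sum_univ_three]
  simp only [gen, ← map_pow, ← map_add]
  rw [Ideal.Quotient.eq_zero_iff_mem, ← e]
  exact Ideal.subset_span rfl

/-- The universal property of the Pham-Brieskorn ring. -/
noncomputable def lift {R : Type*} [CommRing R] [Algebra k R] (x y z : R)
    (h : x ^ a + y ^ b + z ^ c = 0) : PBRing k ![a, b, c] →ₐ[k] R :=
  Ideal.Quotient.liftₐ _ (MvPolynomial.aeval ![x, y, z]) fun f hf => by
    obtain ⟨r, rfl⟩ := Ideal.mem_span_singleton.mp hf
    rw [map_mul, Fin.sum_univ_three]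
    simp [h]

theorem lift_gen {R : Type*} [CommRing R] [Algebra k R] {x y z : R}
    (h : x ^ a + y ^ b + z ^ c = 0) (i : Fin 3) :
    lift x y z h (gen k a b c i) = ![x, y, z] i := by
  have : lift x y z h (gen k a b c i) = MvPolynomial.aeval ![x, y, z] (MvPolynomial.X i) := rfl
  rw [this, MvPolynomial.aeval_X]

theorem adjoin_gen :
    Algebra.adjoin k (Set.range (gen k a b c)) = ⊤ := by
  have h := congrArg (Subalgebra.map (Ideal.Quotient.mkₐ k
    (Ideal.span {∑ i : Fin 3, (MvPolynomial.X i : MvPolynomial (Fin 3) k) ^ ![a, b, c] i})))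
    (MvPolynomial.adjoin_range_X (R := k) (σ := Fin 3))
  rw [AlgHom.map_adjoin, Algebra.map_top, ← Set.range_comp,
    (AlgHom.range_eq_top _).mpr (Ideal.Quotient.mkₐ_surjective _ _)] at h
  exact h

/-- The monomial `x ^ i * y ^ j * z ^ l` in the generators. -/
noncomputable def mon (k : Type*) [Field k] (a b c : ℕ) (i j l : ℕ) : PBRing k ![a, b, c] :=
  gen k a b c 0 ^ i * gen k a b c 1 ^ j * gen k a b c 2 ^ l

theorem span_mon : Submodule.span k
    (Set.range fun e : ℕ × ℕ × ℕ => mon k a b c e.1 e.2.1 e.2.2) = ⊤ := by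
  rw [eq_top_iff, ← Algebra.top_toSubmodule, ← adjoin_gen, Algebra.adjoin_eq_span]
  refine Submodule.span_mono fun f hf => ?_
  induction hf using Submonoid.closure_induction with
  | mem x hx =>
    obtain ⟨i, rfl⟩ := hx
    fin_cases i
    · exact ⟨(1, 0, 0), by simp [mon]⟩
    · exact ⟨(0, 1, 0), by simp [mon]⟩
    · exact ⟨(0, 0, 1), by simp [mon]⟩
  | one => exact ⟨(0, 0, 0), by simp [mon]⟩
  | mul x y _ _ hx hy =>
    obtain ⟨e, rfl⟩ := hx
    obtain ⟨e', rfl⟩ := hy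
    exact ⟨e + e', by simp only [mon, Prod.fst_add, Prod.snd_add, pow_add]; ring⟩

end PBRing

/-! ### The grading and its homogeneous elements -/

section Weights

variable {k : Type*} [Field k] {a b c g : ℕ}

/-- The weighted degree of `x ^ i * y ^ j * z ^ l` in the Pham-Brieskorn ring with exponents
`a`, `b * g`, `c * g`. -/
def weight (a b c g i j l : ℕ) : ℕ := i * (b * c * g) + a * (c * j + b * l)

/-- The grading of the Pham-Brieskorn ring with exponents `a`, `b * g`, `c * g`. -/
noncomputable def grading (k : Type*) [Field k] (a b c g : ℕ) :
    PBRing k ![a, b * g, c * g] →ₐ[k] (PBRing k ![a, b * g, c * g])[X] :=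
  lift (monomial (weight a b c g 1 0 0) (gen k a (b * g) (c * g) 0))
    (monomial (weight a b c g 0 1 0) (gen k a (b * g) (c * g) 1))
    (monomial (weight a b c g 0 0 1) (gen k a (b * g) (c * g) 2)) (by
      simp only [monomial_pow]
      rw [show weight a b c g 1 0 0 * a = a * b * c * g by simp only [weight]; ring,
        show weight a b c g 0 1 0 * (b * g) = a * b * c * g by simp only [weight]; ring,
        show weight a b c g 0 0 1 * (c * g) = a * b * c * g by simp only [weight]; ring,
        ← map_add, ← map_add, gen_relation, map_zero])

theorem grading_gen (i : Fin 3) : grading k a b c g (gen k a (b * g) (c * g) i) =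
    monomial (![weight a b c g 1 0 0, weight a b c g 0 1 0, weight a b c g 0 0 1] i)
      (gen k a (b * g) (c * g) i) := by
  rw [grading, lift_gen]
  fin_cases i <;> rfl

theorem grading_mon (i j l : ℕ) : grading k a b c g (mon k a (b * g) (c * g) i j l) =
    monomial (weight a b c g i j l) (mon k a (b * g) (c * g) i j l) := by
  simp only [mon, map_mul, map_pow, grading_gen, monomial_pow, monomial_mul_monomial]
  refine congrArg (fun n => monomial n _) ?_
  simp [weight]
  ring

/-- The weights of the generators, as a function on the ring. -/
theorem exists_weight_fun : ∃ w : PBRing k ![a, b * g, c * g] → ℕ,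
    ∀ x ∈ Set.range (gen k a (b * g) (c * g)), grading k a b c g x = monomial (w x) x := by
  have : ∀ x : PBRing k ![a, b * g, c * g], ∃ n, x ∈ Set.range (gen k a (b * g) (c * g)) →
      grading k a b c g x = monomial n x := by
    intro x
    by_cases hx : x ∈ Set.range (gen k a (b * g) (c * g))
    · obtain ⟨i, rfl⟩ := hx
      exact ⟨_, fun _ => grading_gen i⟩
    · exact ⟨0, fun h => absurd h hx⟩
  choose w hw using this
  exact ⟨w, hw⟩

theorem isGrading_grading : IsGrading (grading k a b c g) := by
  obtain ⟨w, hw⟩ := exists_weight_fun (k := k) (a := a) (b := b) (c := c) (g := g)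
  exact isGrading_of_adjoin_eq_top adjoin_gen w hw

/-- A homogeneous element is a linear combination of monomials of the same weight. -/
theorem mem_span_mon {d : ℕ} {f : PBRing k ![a, b * g, c * g]}
    (hf : grading k a b c g f = monomial d f) :
    f ∈ Submodule.span k {h | ∃ i j l, weight a b c g i j l = d ∧
      mon k a (b * g) (c * g) i j l = h} := by
  have key : ∀ f : PBRing k ![a, b * g, c * g], homPart (grading k a b c g) d f ∈
      Submodule.span k {h | ∃ i j l, weight a b c g i j l = d ∧
        mon k a (b * g) (c * g) i j l = h} := by
    intro f
    have hf : f ∈ Submodule.span k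
        (Set.range fun e : ℕ × ℕ × ℕ => mon k a (b * g) (c * g) e.1 e.2.1 e.2.2) := by
      rw [span_mon]; trivial
    induction hf using Submodule.span_induction with
    | mem x hx =>
      obtain ⟨⟨i, j, l⟩, rfl⟩ := hx
      rw [homPart_of_map_eq (grading_mon i j l)]
      split_ifs with h
      · exact Submodule.subset_span ⟨i, j, l, by exact_mod_cast h.symm, rfl⟩
      · exact zero_mem _
    | zero => simp
    | add x y _ _ hx hy => rw [map_add]; exact add_mem hx hy
    | smul r x _ hx => rw [map_smul]; exact Submodule.smul_mem _ _ hx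
  have := key f
  rwa [homPart_of_map_eq hf, if_pos rfl] at this

/-- All exponents of a given weight differ from one of them by trading `x ^ a`, `y ^ b` and
`z ^ c` against each other. -/
theorem exists_exponents (ha : a ≠ 0) (hb : b ≠ 0) (hc : c ≠ 0) (hbc : b.Coprime c)
    (hab : a.Coprime (b * g)) (hac : a.Coprime (c * g)) (I J K : ℕ) :
    ∃ i₀ j₀ l₀ M, weight a b c g I J K = weight a b c g i₀ j₀ l₀ + a * b * c * M ∧
      ∀ i j l, weight a b c g i j l = weight a b c g I J K → ∃ m₁ m₂ m₃,
        i = i₀ + a * m₁ ∧ j = j₀ + b * m₂ ∧ l = l₀ + c * m₃ ∧ g * m₁ + m₂ + m₃ = M := by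
  have habcg : a.Coprime (b * c * g) := by
    have h1 : a.Coprime b := hab.coprime_dvd_right (dvd_mul_right _ _)
    rw [mul_assoc]
    exact h1.mul_right hac
  have hab1 : a.Coprime b := hab.coprime_dvd_right (dvd_mul_right _ _)
  have hac1 : a.Coprime c := hac.coprime_dvd_right (dvd_mul_right _ _)
  have expand : ∀ i j l, weight a b c g i j l = weight a b c g (i % a) (j % b) (l % c) +
      a * b * c * (g * (i / a) + j / b + l / c) := by
    intro i j l
    conv_lhs => rw [← Nat.mod_add_div i a, ← Nat.mod_add_div j b, ← Nat.mod_add_div l c]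
    simp only [weight]
    ring
  refine ⟨I % a, J % b, K % c, g * (I / a) + J / b + K / c, expand I J K, ?_⟩
  intro i j l h
  have hi : i % a = I % a := by
    have h1 : i * (b * c * g) ≡ I * (b * c * g) [MOD a] := by
      have := congrArg (· % a) h
      simpa [weight, Nat.ModEq, Nat.add_mul_mod_self_left] using this
    exact Nat.ModEq.cancel_right_of_coprime habcg h1
  have hj : j % b = J % b := by
    have h1 : a * c * j ≡ a * c * J [MOD b] := by
      have := congrArg (· % b) h
      simp only [weight] at this
      rw [show i * (b * c * g) + a * (c * j + b * l) = a * c * j + b * (i * c * g + a * l) by ring,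
        show I * (b * c * g) + a * (c * J + b * K) = a * c * J + b * (I * c * g + a * K) by ring,
        Nat.add_mul_mod_self_left, Nat.add_mul_mod_self_left] at this
      exact this
    exact Nat.ModEq.cancel_left_of_coprime (hab1.symm.mul_right hbc) h1
  have hl : l % c = K % c := by
    have h1 : a * b * l ≡ a * b * K [MOD c] := by
      have := congrArg (· % c) h
      simp only [weight] at this
      rw [show i * (b * c * g) + a * (c * j + b * l) = a * b * l + c * (i * b * g + a * j) by ring,
        show I * (b * c * g) + a * (c * J + b * K) = a * b * K + c * (I * b * g + a * J) by ring,
        Nat.add_mul_mod_self_left, Nat.add_mul_mod_self_left] at this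
      exact this
    exact Nat.ModEq.cancel_left_of_coprime (hac1.symm.mul_right hbc.symm) h1
  refine ⟨i / a, j / b, l / c, ?_, ?_, ?_, ?_⟩
  · rw [← hi, Nat.mod_add_div]
  · rw [← hj, Nat.mod_add_div]
  · rw [← hl, Nat.mod_add_div]
  · rw [expand i j l, expand I J K, hi, hj, hl] at h
    exact Nat.eq_of_mul_eq_mul_left (by positivity) (Nat.add_left_cancel h)

/-- The structure of homogeneous elements: a non-zero one is the product of a monomial and a binary
form in `y ^ b` and `z ^ c`. -/
theorem exists_eq_mon_mul (ha : a ≠ 0) (hb : b ≠ 0) (hc : c ≠ 0) (hbc : b.Coprime c)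
    (hab : a.Coprime (b * g)) (hac : a.Coprime (c * g)) {d : ℕ} {f : PBRing k ![a, b * g, c * g]}
    (hf : grading k a b c g f = monomial d f) (hf0 : f ≠ 0) :
    ∃ i₀ j₀ l₀ M, d = weight a b c g i₀ j₀ l₀ + a * b * c * M ∧
      ∃ h ∈ binaryForms k (gen k a (b * g) (c * g) 1 ^ b) (gen k a (b * g) (c * g) 2 ^ c) M,
        f = mon k a (b * g) (c * g) i₀ j₀ l₀ * h := by
  have hmem := mem_span_mon hf
  obtain ⟨_, ⟨I, J, K, rfl, -⟩⟩ : Set.Nonempty {h | ∃ i j l, weight a b c g i j l = d ∧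
      mon k a (b * g) (c * g) i j l = h} := by
    by_contra hempty
    rw [Set.not_nonempty_iff_eq_empty] at hempty
    rw [hempty, Submodule.span_empty] at hmem
    exact hf0 hmem
  obtain ⟨i₀, j₀, l₀, M, hd, hM⟩ := exists_exponents ha hb hc hbc hab hac I J K
  refine ⟨i₀, j₀, l₀, M, hd, ?_⟩
  set u := gen k a (b * g) (c * g) 1 ^ b with hu
  set v := gen k a (b * g) (c * g) 2 ^ c with hv
  have hsub : Submodule.span k {h | ∃ i j l, weight a b c g i j l = weight a b c g I J K ∧
      mon k a (b * g) (c * g) i j l = h} ≤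
      (binaryForms k u v M).map (LinearMap.mulLeft k (mon k a (b * g) (c * g) i₀ j₀ l₀)) := by
    rw [Submodule.span_le]
    rintro _ ⟨i, j, l, hw, rfl⟩
    obtain ⟨m₁, m₂, m₃, rfl, rfl, rfl, rfl⟩ := hM i j l hw
    refine ⟨(gen k a (b * g) (c * g) 0 ^ a) ^ m₁ * u ^ m₂ * v ^ m₃, ?_, ?_⟩
    · have hx : gen k a (b * g) (c * g) 0 ^ a ∈ binaryForms k u v g := by
        have h1 : gen k a (b * g) (c * g) 0 ^ a = -(u ^ g + v ^ g) := by
          have := gen_relation (k := k) (a := a) (b := b * g) (c := c * g)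
          rw [hu, hv, ← pow_mul, ← pow_mul]
          linear_combination this
        rw [h1]
        refine neg_mem (add_mem ?_ ?_)
        · simpa using pow_mem_binaryForms (left_mem_binaryForms (k := k) u v) g
        · simpa using pow_mem_binaryForms (right_mem_binaryForms (k := k) u v) g
      refine mul_mem_binaryForms (mul_mem_binaryForms (pow_mem_binaryForms hx m₁) ?_) ?_
      · simpa using pow_mem_binaryForms (left_mem_binaryForms (k := k) u v) m₂
      · simpa using pow_mem_binaryForms (right_mem_binaryForms (k := k) u v) m₃
    · simp only [LinearMap.mulLeft_apply, mon, hu, hv]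
      ring
  obtain ⟨h, hh, rfl⟩ := hsub hmem
  exact ⟨h, hh, rfl⟩

/-- The elements of degree zero are the constants, because all weights are positive. -/
theorem exists_eq_smul_one (ha : a ≠ 0) (hb : b ≠ 0) (hc : c ≠ 0) (hg : g ≠ 0)
    {f : PBRing k ![a, b * g, c * g]} (hf : grading k a b c g f = monomial 0 f) :
    ∃ r : k, f = r • 1 := by
  have hmem := mem_span_mon hf
  have : {h | ∃ i j l, weight a b c g i j l = 0 ∧ mon k a (b * g) (c * g) i j l = h} ⊆ {1} := by
    rintro _ ⟨i, j, l, hw, rfl⟩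
    simp only [weight, Nat.add_eq_zero_iff, mul_eq_zero, ha, hb, hc, hg, or_false, false_or] at hw
    obtain ⟨rfl, rfl, rfl⟩ := hw
    simp [mon]
  obtain ⟨r, hr⟩ := Submodule.mem_span_singleton.mp (Submodule.span_mono this hmem)
  exact ⟨r, hr.symm⟩

end Weights

/-! ### The ring is a domain -/

section Domain

variable {k : Type*} [Field k] {a b c g : ℕ}

/-- The polynomial `-(V ^ (b * g) + 1)`. -/
noncomputable def chartPoly (k : Type*) [Field k] (b g : ℕ) : k[X] := -(X ^ (b * g) + C 1)

theorem chartPoly_ne_zero (hb : b ≠ 0) (hg : g ≠ 0) : chartPoly k b g ≠ 0 :=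
  neg_ne_zero.mpr (monic_X_pow_add_C 1 (mul_ne_zero hb hg)).ne_zero

/-- A parametrised curve on the surface `x ^ a + y ^ (b * g) + z ^ (c * g) = 0`.  With
`W = -(V ^ (b * g) + 1)`, `y = W ^ (n * c) * V` and `z = W ^ (n * b)`, the sum of the last two terms
is `-W ^ (n * b * c * g + 1)`, and `n` is chosen so that this exponent is a multiple of `a`. -/
theorem exists_chart (ha : a ≠ 0) (hb : b ≠ 0) (hc : c ≠ 0) (hg : g ≠ 0)
    (habcg : a.Coprime (b * c * g)) :
    ∃ (n l : ℕ) (ε : PBRing k ![a, b * g, c * g] →ₐ[k] k[X]),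
      ε (gen k a (b * g) (c * g) 0) = chartPoly k b g ^ l ∧
      ε (gen k a (b * g) (c * g) 1) = chartPoly k b g ^ (n * c) * X ∧
      ε (gen k a (b * g) (c * g) 2) = chartPoly k b g ^ (n * b) := by
  obtain ⟨n, l, hnl⟩ : ∃ n l, n * (b * c * g) + 1 = l * a := by
    rcases Nat.lt_or_ge 1 a with h1 | h1
    · have : NeZero (b * c * g) := ⟨by simp [hb, hc, hg]⟩
      obtain ⟨m, hm⟩ := Nat.exists_mul_mod_eq_one_of_coprime habcg.symm h1
      -- `m` is an inverse of `b * c * g` modulo `a`, so `(a - 1) * m` is an inverse of its negative.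
      refine ⟨(a - 1) * m, (a - 1) * (b * c * g * m / a) + 1, ?_⟩
      have h2 := Nat.mod_add_div (b * c * g * m) a
      rw [hm.2] at h2
      obtain ⟨a', rfl⟩ : ∃ a', a = a' + 1 := ⟨a - 1, by omega⟩
      rw [Nat.add_sub_cancel]
      calc a' * m * (b * c * g) + 1 = a' * (b * c * g * m) + 1 := by ring
        _ = a' * (1 + (a' + 1) * (b * c * g * m / (a' + 1))) + 1 := by rw [h2]
        _ = _ := by ring
    · exact ⟨0, 1, by omega⟩
  set W := chartPoly k b g with hW
  have hrel : (W ^ l) ^ a + (W ^ (n * c) * X) ^ (b * g) + (W ^ (n * b)) ^ (c * g) = 0 := by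
    rw [mul_pow, ← pow_mul, ← pow_mul, ← pow_mul, ← hnl,
      show n * c * (b * g) = n * (b * c * g) by ring, show n * b * (c * g) = n * (b * c * g) by ring,
      pow_succ]
    have : W + X ^ (b * g) + 1 = 0 := by rw [hW, chartPoly, C_1]; ring
    linear_combination W ^ (n * (b * c * g)) * this
  refine ⟨n, l, lift _ _ _ hrel, ?_, ?_, ?_⟩ <;> simp [lift_gen]

/-- The parametrisation is injective on the elements of each degree: on a binary form it amounts to
dehomogenising and substituting `V ^ b`. -/
theorem eq_zero_of_chart (ha : a ≠ 0) (hb : b ≠ 0) (hc : c ≠ 0) (hg : g ≠ 0) (hbc : b.Coprime c)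
    (hab : a.Coprime (b * g)) (hac : a.Coprime (c * g)) {n l : ℕ}
    {ε : PBRing k ![a, b * g, c * g] →ₐ[k] k[X]}
    (h0 : ε (gen k a (b * g) (c * g) 0) = chartPoly k b g ^ l)
    (h1 : ε (gen k a (b * g) (c * g) 1) = chartPoly k b g ^ (n * c) * X)
    (h2 : ε (gen k a (b * g) (c * g) 2) = chartPoly k b g ^ (n * b))
    {d : ℕ} {f : PBRing k ![a, b * g, c * g]} (hf : grading k a b c g f = monomial d f)
    (hεf : ε f = 0) : f = 0 := by
  by_contra hf0
  obtain ⟨i₀, j₀, l₀, M, -, h, hh, rfl⟩ := exists_eq_mon_mul ha hb hc hbc hab hac hf hf0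
  have hW := chartPoly_ne_zero (k := k) hb hg
  have hmon : ε (mon k a (b * g) (c * g) i₀ j₀ l₀) ≠ 0 := by
    simp [mon, h0, h1, h2, hW]
  rw [map_mul] at hεf
  have hεh := (mul_eq_zero.mp hεf).resolve_left hmon
  obtain ⟨p, hp, rfl⟩ := mem_binaryForms.mp hh
  have hvec : (fun i => ε (![gen k a (b * g) (c * g) 1 ^ b, gen k a (b * g) (c * g) 2 ^ c] i)) =
      ![chartPoly k b g ^ (n * b * c) * X ^ b, chartPoly k b g ^ (n * b * c)] := by
    funext i
    fin_cases i
    · simp [h1, mul_pow, ← pow_mul, mul_right_comm n c b]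
    · simp [h2, ← pow_mul]
  rw [MvPolynomial.comp_aeval_apply, hvec, aeval_homogenize_mul hp] at hεh
  have h3 := (mul_eq_zero.mp hεh).resolve_left (pow_ne_zero _ (pow_ne_zero _ hW))
  have h4 : p = 0 := by
    rw [← expand_eq_zero (Nat.pos_of_ne_zero hb), expand_eq_comp_X_pow, ← h3]
    rfl
  apply hf0
  simp [h4]

/-- The Pham-Brieskorn ring embeds into a polynomial ring in two variables, one for the
parametrisation of a curve and one for the degree. -/
theorem isDomain_PBRing (ha : a ≠ 0) (hb : b ≠ 0) (hc : c ≠ 0) (hg : g ≠ 0) (hbc : b.Coprime c)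
    (hab : a.Coprime (b * g)) (hac : a.Coprime (c * g)) :
    IsDomain (PBRing k ![a, b * g, c * g]) := by
  have habcg : a.Coprime (b * c * g) := by
    rw [mul_assoc]
    exact (hab.coprime_dvd_right (dvd_mul_right _ _)).mul_right hac
  obtain ⟨n, l, ε, h0, h1, h2⟩ := exists_chart (k := k) ha hb hc hg habcg
  have hinj : Function.Injective ((mapAlgHom ε).comp (grading k a b c g)) := by
    rw [injective_iff_map_eq_zero]
    intro f hf
    refine isGrading_grading.eq_zero_of_homPart fun d => ?_
    refine eq_zero_of_chart ha hb hc hg hbc hab hac h0 h1 h2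
      (isGrading_grading.map_homPart d f) ?_
    have := congrArg (fun F => F.coeff d) hf
    simpa [homPart_natCast, coeff_map] using this
  exact hinj.isDomain

end Domain

/-! ### Homogeneous exponential maps -/

section HomogeneousExponentialMaps

variable {k B : Type*} [CommRing k] [CommRing B] [Algebra k B] {γ ψ : B →ₐ[k] B[X]} {P : ℤ}

/-- The homogeneous parts of an element have degree at most that of the element under a homogeneous
exponential map, so the smallest positive degree is attained by a homogeneous element. -/
theorem exists_homogeneous_minimal (hγ : IsGrading γ) (hψ : IsExponentialMap ψ)
    (hne : invariants ψ ≠ Set.univ)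
    (hP : ∀ (d : ℤ) (b : B) (i : ℕ),
      (ψ (homPart γ d b)).coeff i = homPart γ (d + i * P) ((ψ b).coeff i)) :
    ∃ (d : ℕ) (t : B), γ t = monomial d t ∧ 0 < (ψ t).natDegree ∧
      ∀ f, (ψ f).natDegree < (ψ t).natDegree → (ψ f).natDegree = 0 := by
  classical
  have hex : ∃ n, 0 < n ∧ ∃ f, (ψ f).natDegree = n := by
    obtain ⟨f, hf⟩ := (Set.ne_univ_iff_exists_notMem _).mp hne
    rw [hψ.mem_invariants_iff] at hf
    exact ⟨_, Nat.pos_of_ne_zero hf, f, rfl⟩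
  obtain ⟨hpos, f, hf⟩ := Nat.find_spec hex
  have hmin : ∀ h, (ψ h).natDegree < Nat.find hex → (ψ h).natDegree = 0 := by
    intro h hlt
    by_contra h0
    exact Nat.find_min hex hlt ⟨Nat.pos_of_ne_zero h0, h, rfl⟩
  have hle : ∀ d : ℕ, (ψ (homPart γ d f)).natDegree ≤ Nat.find hex := by
    intro d
    rw [natDegree_le_iff_coeff_eq_zero]
    intro i hi
    rw [hP, coeff_eq_zero_of_natDegree_lt (by omega), map_zero]
  obtain ⟨d, hd⟩ : ∃ d : ℕ, 0 < (ψ (homPart γ d f)).natDegree := by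
    by_contra hall
    have h0 : ∀ d : ℕ, (ψ (homPart γ d f)).natDegree = 0 := by
      intro d
      by_contra h
      exact hall ⟨d, Nat.pos_of_ne_zero h⟩
    have h1 : (ψ f).natDegree ≤ 0 := by
      rw [← hγ.sum_homPart f, map_sum]
      exact natDegree_sum_le_of_forall_le _ _ fun d _ => (h0 d).le
    omega
  have heq : (ψ (homPart γ d f)).natDegree = Nat.find hex := by
    refine le_antisymm (hle d) ?_
    by_contra hlt
    exact hd.ne' (hmin _ (not_le.mp hlt))
  exact ⟨d, homPart γ d f, hγ.map_homPart d f, hd, by rwa [heq]⟩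

/-- The leading coefficient of the image of a homogeneous element is homogeneous. -/
theorem exists_leadingCoeff_homogeneous (hγ : IsGrading γ)
    (hP : ∀ (d : ℤ) (b : B) (i : ℕ),
      (ψ (homPart γ d b)).coeff i = homPart γ (d + i * P) ((ψ b).coeff i)) {d : ℕ} {f : B}
    (hf : γ f = monomial d f) (hf0 : (ψ f).leadingCoeff ≠ 0) :
    ∃ e : ℕ, (e : ℤ) = d + (ψ f).natDegree * P ∧
      γ (ψ f).leadingCoeff = monomial e (ψ f).leadingCoeff := by
  have h1 := hP d f (ψ f).natDegree
  rw [homPart_of_map_eq hf, if_pos rfl, coeff_natDegree] at h1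
  have hnn : 0 ≤ (d : ℤ) + (ψ f).natDegree * P := by
    by_contra hneg
    rw [homPart_of_neg (not_le.mp hneg)] at h1
    exact hf0 h1
  obtain ⟨e, he⟩ : ∃ e : ℕ, (e : ℤ) = d + (ψ f).natDegree * P := ⟨_, Int.toNat_of_nonneg hnn⟩
  rw [← he] at h1
  refine ⟨e, he, ?_⟩
  rw [h1, hγ.map_homPart]

end HomogeneousExponentialMaps

universe u

/-! ### Rigidity -/

section Rigidity

variable {k : Type*} [Field k] {a b c g : ℕ}

theorem smul_gen_pow_ne (hb : b ≠ 0) (hg : g ≠ 0) (ha : a ≠ 0) (hc : c ≠ 0)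
    (habcg : a.Coprime (b * c * g)) {r s : k} (hr : r ≠ 0) :
    r • gen k a (b * g) (c * g) 1 ^ b - s • gen k a (b * g) (c * g) 2 ^ c ≠ 0 := by
  intro h
  obtain ⟨n, l, ε, -, h1, h2⟩ := exists_chart (k := k) ha hb hc hg habcg
  have h3 := congrArg ε h
  have hW := chartPoly_ne_zero (k := k) hb hg
  rw [map_sub, map_smul, map_smul, map_pow, map_pow, h1, h2, map_zero, mul_pow, ← pow_mul,
    ← pow_mul, mul_right_comm n c b, smul_eq_C_mul, smul_eq_C_mul] at h3
  have h4 : chartPoly k b g ^ (n * b * c) * (C r * X ^ b - C s) = 0 := by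
    linear_combination h3
  have h5 := (mul_eq_zero.mp h4).resolve_left (pow_ne_zero _ hW)
  have h6 := congrArg (fun p => p.coeff b) h5
  simp [coeff_C, hb, hr] at h6

/-- A non-trivial homogeneous exponential map on the Pham-Brieskorn ring has a non-zero homogeneous
invariant of positive degree.  Otherwise `y ^ b` and `z ^ c` would have images with constant leading
coefficients, of the same degree as the image of every non-zero homogeneous element of the same
degree as `y ^ b` and `z ^ c`; this fails for a linear combination in which the leading terms
cancel. -/
theorem exists_homogeneous_invariant (ha : a ≠ 0) (hb : b ≠ 0) (hc : c ≠ 0) (hg : g ≠ 0)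
    (hbc : b.Coprime c) (hab : a.Coprime (b * g)) (hac : a.Coprime (c * g)) {q : ℕ} (hq : 0 < q)
    {γ ψ : PBRing k ![a, b * g, c * g] →ₐ[k] (PBRing k ![a, b * g, c * g])[X]} {P : ℤ}
    (hγ : γ = ((Polynomial.expand _ q).restrictScalars k).comp (grading k a b c g))
    (hψ : IsExponentialMap ψ)
    (hP : ∀ (d : ℤ) f (i : ℕ),
      (ψ (homPart γ d f)).coeff i = homPart γ (d + i * P) ((ψ f).coeff i)) :
    ∃ (d : ℕ) (f : PBRing k ![a, b * g, c * g]), d ≠ 0 ∧ f ≠ 0 ∧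
      grading k a b c g f = monomial d f ∧ f ∈ invariants ψ := by
  have hdom := isDomain_PBRing (k := k) ha hb hc hg hbc hab hac
  have habcg : a.Coprime (b * c * g) := by
    rw [mul_assoc]
    exact (hab.coprime_dvd_right (dvd_mul_right _ _)).mul_right hac
  have hγg : IsGrading γ := hγ ▸ isGrading_grading.expand hq
  by_contra hno
  set D := a * b * c with hD
  have hD0 : D ≠ 0 := mul_ne_zero (mul_ne_zero ha hb) hc
  have key : ∀ f : PBRing k ![a, b * g, c * g], f ≠ 0 → grading k a b c g f = monomial D f →
      ((q * D : ℕ) : ℤ) + (ψ f).natDegree * P = 0 ∧ ∃ r : k, (ψ f).leadingCoeff = r • 1 := by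
    intro f hf0 hf
    have hfγ : γ f = monomial (q * D) f := by
      simp [hγ, hf, expand_monomial, mul_comm]
    have hψf : (ψ f).leadingCoeff ≠ 0 :=
      leadingCoeff_ne_zero.mpr fun h => hf0 (hψ.injective (by rw [h, map_zero]))
    obtain ⟨m, hm, hγm⟩ := exists_leadingCoeff_homogeneous hγg hP hfγ hψf
    rw [hγ] at hγm
    obtain ⟨e, rfl, he⟩ := exists_of_expand_comp_eq_monomial hq hψf hγm
    have he0 : e = 0 := by
      by_contra he0
      exact hno ⟨e, _, he0, hψf, he, hψ.leadingCoeff_mem f⟩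
    subst he0
    refine ⟨by rw [← hm]; simp, exists_eq_smul_one ha hb hc hg he⟩
  set u := gen k a (b * g) (c * g) 1 ^ b with hu
  set v := gen k a (b * g) (c * g) 2 ^ c with hv
  have hγu : grading k a b c g u = monomial D u := by
    have := grading_mon (k := k) (a := a) (b := b) (c := c) (g := g) 0 b 0
    rw [show weight a b c g 0 b 0 = D by simp only [weight, hD]; ring] at this
    rwa [mon, pow_zero, pow_zero, one_mul, mul_one, ← hu] at this
  have hγv : grading k a b c g v = monomial D v := by
    have := grading_mon (k := k) (a := a) (b := b) (c := c) (g := g) 0 0 c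
    rw [show weight a b c g 0 0 c = D by simp only [weight, hD]; ring] at this
    rwa [mon, pow_zero, pow_zero, one_mul, one_mul, ← hv] at this
  have hu0 : u ≠ 0 := by
    have := smul_gen_pow_ne hb hg ha hc habcg (r := (1 : k)) (s := 0) one_ne_zero
    rwa [one_smul, zero_smul, sub_zero] at this
  have hlin := fun r s (hr : r ≠ (0 : k)) => smul_gen_pow_ne hb hg ha hc habcg (s := s) hr
  rw [← hu, ← hv] at hlin
  have hv0 : v ≠ 0 := by
    intro hv0
    obtain ⟨n, l, ε, -, -, h2⟩ := exists_chart (k := k) ha hb hc hg habcg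
    have := congrArg ε hv0
    rw [hv, map_pow, h2, map_zero] at this
    exact pow_ne_zero _ (pow_ne_zero _ (chartPoly_ne_zero hb hg)) this
  obtain ⟨hu1, r, hr⟩ := key u hu0 hγu
  obtain ⟨hv1, s, hs⟩ := key v hv0 hγv
  have hs0 : s ≠ 0 := by
    rintro rfl
    rw [zero_smul, leadingCoeff_eq_zero] at hs
    exact hv0 (hψ.injective (by rw [hs, map_zero]))
  have hw0 := hlin s r hs0
  obtain ⟨hw1, -⟩ := key (s • u - r • v) hw0 (by simp [hγu, hγv])
  have hqD : ((q * D : ℕ) : ℤ) ≠ 0 := by exact_mod_cast mul_ne_zero hq.ne' hD0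
  have hP0 : P ≠ 0 := by
    rintro rfl
    simp only [mul_zero, add_zero] at hu1
    exact hqD hu1
  have huv : (ψ v).natDegree = (ψ u).natDegree := by
    have : ((ψ v).natDegree : ℤ) * P = (ψ u).natDegree * P := by linarith
    exact_mod_cast mul_right_cancel₀ hP0 this
  have huw : (ψ (s • u - r • v)).natDegree = (ψ u).natDegree := by
    have : ((ψ (s • u - r • v)).natDegree : ℤ) * P = (ψ u).natDegree * P := by linarith
    exact_mod_cast mul_right_cancel₀ hP0 this
  apply hw0
  apply hψ.injective
  rw [map_zero, ← leadingCoeff_eq_zero, leadingCoeff, huw, map_sub, map_smul, map_smul, coeff_sub,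
    coeff_smul, coeff_smul, coeff_natDegree, hr]
  rw [← huv, coeff_natDegree, hs, smul_smul, smul_smul, mul_comm s r, sub_self]

/-- Under an embedding into `L[T]`, homogeneous elements become products of basic factors. -/
theorem exists_prod_basicFactors (ha : a ≠ 0) (hb : b ≠ 0) (hc : c ≠ 0) (hbc : b.Coprime c)
    (hab : a.Coprime (b * g)) (hac : a.Coprime (c * g)) {L : Type*} [Field L] [IsAlgClosed L]
    [Algebra k L] (ρ : PBRing k ![a, b * g, c * g] →ₐ[k] L[X])
    {d : ℕ} {f : PBRing k ![a, b * g, c * g]} (hf : grading k a b c g f = monomial d f)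
    (hf0 : f ≠ 0) :
    ∃ (r : L) (s : Multiset L[X]), ρ f = C r * s.prod ∧ (s = 0 → d = 0) ∧
      ∀ h ∈ s, IsBasicFactor b c (ρ (gen k a (b * g) (c * g) 0)) (ρ (gen k a (b * g) (c * g) 1))
        (ρ (gen k a (b * g) (c * g) 2)) h := by
  obtain ⟨i, j, l, M, hd, h, hh, rfl⟩ := exists_eq_mon_mul ha hb hc hbc hab hac hf hf0
  obtain ⟨p, hp, rfl⟩ := mem_binaryForms.mp hh
  set x := ρ (gen k a (b * g) (c * g) 0) with hx
  set y := ρ (gen k a (b * g) (c * g) 1) with hy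
  set z := ρ (gen k a (b * g) (c * g) 2) with hz
  have hvec : (fun i => ρ (![gen k a (b * g) (c * g) 1 ^ b, gen k a (b * g) (c * g) 2 ^ c] i)) =
      ![y ^ b, z ^ c] := by
    funext i
    fin_cases i <;> simp [hy, hz]
  obtain ⟨r, s, hs, h⟩ := exists_eq_prod_linear (y ^ b) (z ^ c) M (p.map (algebraMap k L))
    (natDegree_map_le.trans hp)
  rw [homogenize_map, MvPolynomial.aeval_map_algebraMap] at h
  refine ⟨r, Multiset.replicate i x + Multiset.replicate j y + Multiset.replicate l z +
    s.map fun r => r.1 • y ^ b + r.2 • z ^ c, ?_, ?_, ?_⟩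
  · rw [map_mul, MvPolynomial.comp_aeval_apply, hvec, h]
    simp only [mon, map_mul, map_pow, ← hx, ← hy, ← hz, Multiset.prod_add, Multiset.prod_replicate,
      Polynomial.algebraMap_apply, Algebra.algebraMap_self, RingHom.id_apply]
    ring
  · intro h0
    have hcard := congrArg Multiset.card h0
    simp only [Multiset.card_add, Multiset.card_replicate, Multiset.card_map, hs,
      Multiset.card_zero] at hcard
    obtain ⟨rfl, rfl, rfl, rfl⟩ : i = 0 ∧ j = 0 ∧ l = 0 ∧ M = 0 := by omega
    simp [hd, weight]
  · intro h hmem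
    simp only [Multiset.mem_add, Multiset.mem_replicate, Multiset.mem_map] at hmem
    rcases hmem with ((⟨-, rfl⟩ | ⟨-, rfl⟩) | ⟨-, rfl⟩) | ⟨e, -, rfl⟩
    · exact .inl rfl
    · exact .inr (.inl rfl)
    · exact .inr (.inr (.inl rfl))
    · exact .inr (.inr (.inr ⟨e.1, e.2, by rw [smul_eq_C_mul, smul_eq_C_mul]⟩))

theorem exists_isAlgClosed_extension (k : Type*) (B : Type u) [Field k] [CommRing B] [IsDomain B]
    [Algebra k B] : ∃ (L : Type u) (_ : Field L) (_ : IsAlgClosed L) (_ : Algebra k L)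
      (_ : Algebra B L) (_ : IsScalarTower k B L), FaithfulSMul B L := by
  refine ⟨AlgebraicClosure (FractionRing B), inferInstance, inferInstance, inferInstance,
    inferInstance, inferInstance, ?_⟩
  refine (faithfulSMul_iff_algebraMap_injective B (AlgebraicClosure (FractionRing B))).mpr ?_
  rw [IsScalarTower.algebraMap_eq B (FractionRing B)]
  exact (algebraMap (FractionRing B) _).injective.comp (IsFractionRing.injective _ _)

/-- Rigidity: a non-trivial exponential map would yield an embedding of the ring into `L[T]` under which
one basic factor is constant and another one has degree one. -/
theorem isRigid_PBRing (q : ℕ) [ExpChar k q] (hbc : b.Coprime c) (hab : a.Coprime (b * g))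
    (hac : a.Coprime (c * g)) (ha2 : 2 ≤ a) (hb2 : 2 ≤ b * g) (hc2 : 2 ≤ c * g)
    (hT : ¬ (b * g = 2 ∧ c * g = 2)) (hRb : ∀ e, b * g ∣ q ^ e → ¬ q ^ e ∣ c * g)
    (hRc : ∀ e, c * g ∣ q ^ e → ¬ q ^ e ∣ b * g) :
    IsRigid k (PBRing k ![a, b * g, c * g]) := by
  have ha : a ≠ 0 := by omega
  have hb : b ≠ 0 := by rintro rfl; simp at hb2
  have hc : c ≠ 0 := by rintro rfl; simp at hc2
  have hg : g ≠ 0 := by rintro rfl; simp at hb2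
  have hdom := isDomain_PBRing (k := k) ha hb hc hg hbc hab hac
  have habcg : a.Coprime (b * c * g) := by
    rw [mul_assoc]
    exact (hab.coprime_dvd_right (dvd_mul_right _ _)).mul_right hac
  classical
  rintro ⟨φ, hφ, hφne⟩
  obtain ⟨w, hw⟩ := exists_weight_fun (k := k) (a := a) (b := b) (c := c) (g := g)
  obtain ⟨N, hN, P, γ, ψ, hγ, hψ, hψne, hP⟩ :=
    exists_homogeneous_exponentialMap isGrading_grading hφ hφne
      (s := Finset.univ.image (gen k a (b * g) (c * g))) (w := w)
      (by rw [Finset.coe_image, Finset.coe_univ, Set.image_univ, adjoin_gen])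
      (fun x hx => hw x (by simpa using hx))
  have hγg : IsGrading γ := hγ ▸ isGrading_grading.expand hN
  obtain ⟨d, t, hγt, ht, hmin⟩ := exists_homogeneous_minimal hγg hψ hψne hP
  have ht0 : t ≠ 0 := by
    rintro rfl
    simp at ht
  rw [hγ] at hγt
  obtain ⟨d', -, hgt⟩ := exists_of_expand_comp_eq_monomial hN ht0 hγt
  obtain ⟨e, f, he, hf0, hgf, hfinv⟩ :=
    exists_homogeneous_invariant ha hb hc hg hbc hab hac hN hγ hψ hP
  obtain ⟨L, _, _, _, _, _, _⟩ := exists_isAlgClosed_extension k (PBRing k ![a, b * g, c * g])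
  have : ExpChar L q := expChar_of_injective_algebraMap (algebraMap k L).injective q
  obtain ⟨ρ, hρ, hρt, hρd⟩ := hψ.exists_algHom ht hmin (L := L)
  have hne : ∀ x : PBRing k ![a, b * g, c * g], x ≠ 0 → ρ x ≠ 0 := fun x hx h =>
    hx (hρ (by rw [h, map_zero]))
  obtain ⟨n, l, ε, h0, h1, h2⟩ := exists_chart (k := k) ha hb hc hg habcg
  have hW := chartPoly_ne_zero (k := k) hb hg
  have hgen : ∀ i, ρ (gen k a (b * g) (c * g) i) ≠ 0 := by
    intro i
    refine hne _ fun h => ?_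
    have hε := congrArg ε h
    rw [map_zero] at hε
    fin_cases i
    · exact pow_ne_zero _ hW (h0 ▸ hε)
    · exact mul_ne_zero (pow_ne_zero _ hW) X_ne_zero (h1 ▸ hε)
    · exact pow_ne_zero _ hW (h2 ▸ hε)
  have hrel := congrArg ρ (gen_relation (k := k) (a := a) (b := b * g) (c := c * g))
  rw [map_add, map_add, map_pow, map_pow, map_pow, map_zero] at hrel
  -- All basic factors of the invariant `f` are constant, and there is at least one.
  obtain ⟨r, s, hrs, hs0, hs⟩ := exists_prod_basicFactors ha hb hc hbc hab hac ρ hgf hf0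
  have hfd : (ρ f).natDegree = 0 := by
    have h3 := hρd f
    rw [(hψ.mem_invariants_iff f).mp hfinv] at h3
    exact (mul_eq_zero.mp h3.symm).resolve_right ht.ne'
  have hρf := hne f hf0
  rw [hrs] at hρf hfd
  have hr0 : r ≠ 0 := by
    rintro rfl
    simp at hρf
  have hs00 : (0 : L[X]) ∉ s := fun h => right_ne_zero_of_mul hρf (Multiset.prod_eq_zero h)
  obtain ⟨f₀, hf₀⟩ := Multiset.exists_mem_of_ne_zero fun h => he (hs0 h)
  have hf₀d : f₀.natDegree = 0 := by
    rw [natDegree_C_mul hr0, natDegree_multiset_prod _ hs00] at hfd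
    exact Nat.le_zero.mp ((Multiset.single_le_sum (fun _ _ => Nat.zero_le _) _
      (Multiset.mem_map_of_mem natDegree hf₀)).trans hfd.le)
  -- The degrees of the basic factors of `t` add up to one.
  obtain ⟨r', s', hrs', -, hs'⟩ := exists_prod_basicFactors ha hb hc hbc hab hac ρ hgt ht0
  have hρt0 := hne t ht0
  have htd : (ρ t).natDegree = 1 := by rw [hρt, natDegree_X]
  rw [hrs'] at hρt0 htd
  have hr0' : r' ≠ 0 := by
    rintro rfl
    simp at hρt0
  have hs00' : (0 : L[X]) ∉ s' := fun h => right_ne_zero_of_mul hρt0 (Multiset.prod_eq_zero h)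
  rw [natDegree_C_mul hr0', natDegree_multiset_prod _ hs00'] at htd
  obtain ⟨f₁, hf₁, hf₁d⟩ : ∃ f₁ ∈ s', f₁.natDegree = 1 := by
    by_contra hall
    have hzero : ∀ n ∈ s'.map natDegree, n = 0 := by
      intro n hn
      have hle : n ≤ 1 :=
        (Multiset.single_le_sum (fun _ _ => Nat.zero_le _) _ hn).trans htd.le
      obtain ⟨f₁, hf₁, rfl⟩ := Multiset.mem_map.mp hn
      have : f₁.natDegree ≠ 1 := fun h => hall ⟨f₁, hf₁, h⟩
      omega
    rw [Multiset.sum_eq_zero hzero] at htd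
    omega
  exact false_of_basicFactors q rfl rfl hbc hab hac ha2 hb2 hc2 hT hRb hRc (hgen 0) (hgen 1)
    (hgen 2) hrel (hs f₀ hf₀) hf₀d (fun h => hs00 (h ▸ hf₀)) (hs' f₁ hf₁) hf₁d

/-- The arithmetic condition `(a, b, c) ∉ R` in terms of the characteristic exponent. -/
theorem not_dvd_of_notMem_setR {p q : ℕ} (hpq : p.Prime ∧ q = p ∨ q = 1) {e : Fin 3 → ℕ}
    (he : ∀ i, 0 < e i) (hR : e ∉ setR p 3) {i j : Fin 3} (hij : i ≠ j) (n : ℕ)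
    (h : e i ∣ q ^ n) : ¬ q ^ n ∣ e j := by
  have h1 : ∀ i, e i ≠ 1 := fun i hi => hR ⟨he, .inl ⟨i, hi⟩⟩
  rcases hpq with ⟨hp, rfl⟩ | rfl
  · rintro ⟨s, hs⟩
    obtain ⟨r, hr, hr'⟩ := (Nat.dvd_prime_pow hp).mp h
    have hr0 : r ≠ 0 := by
      rintro rfl
      exact h1 i (by simpa using hr')
    have hs0 : 0 < s := Nat.pos_of_ne_zero fun h0 => (he j).ne' (by rw [hs, h0, mul_zero])
    exact hR ⟨he, .inr ⟨i, j, hij, r, s, n, by omega, hs0, by omega, hr, hr', by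
      rw [hs, mul_comm]⟩⟩
  · rw [one_pow] at h
    exact absurd (Nat.dvd_one.mp h) (h1 i)

end Rigidity

end PhamBrieskorn

theorem mainTheorem6 {k : Type*} [Field k] (p : ℕ) [CharP k p] (a b c : ℕ)
    (habc : ![a, b, c] ∈
      PhamBrieskorn.setF p 3 \ (PhamBrieskorn.setR p 3 ∪ PhamBrieskorn.setT 3))
    (hgcd : Nat.gcd a (b * c) = 1) :
    IsDomain (PhamBrieskorn.PBRing k ![a, b, c]) ∧
      PhamBrieskorn.IsRigid k (PhamBrieskorn.PBRing k ![a, b, c]) := by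
  obtain ⟨⟨hpos, -⟩, hRT⟩ := habc
  rw [Set.mem_union, not_or] at hRT
  obtain ⟨hR, hTmem⟩ := hRT
  obtain ⟨q, hq⟩ := ExpChar.exists k
  have hpq : p.Prime ∧ q = p ∨ q = 1 := by
    rcases hq with _ | hprime
    · exact .inr rfl
    · obtain rfl := CharP.eq k ‹CharP k p› ‹CharP k q›
      exact .inl ⟨hprime, rfl⟩
  have ha0 : 0 < a := hpos 0
  have hb0 : 0 < b := hpos 1
  have hc0 : 0 < c := hpos 2
  have h1 : ∀ i, ![a, b, c] i ≠ 1 := fun i hi => hR ⟨hpos, .inl ⟨i, hi⟩⟩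
  have ha1 : a ≠ 1 := h1 0
  have hb1 : b ≠ 1 := h1 1
  have hc1 : c ≠ 1 := h1 2
  have hT : ¬ (b = 2 ∧ c = 2) := fun h =>
    hTmem ⟨hpos, .inr ⟨1, 2, by decide, h.1, h.2⟩⟩
  have hRb : ∀ e, b ∣ q ^ e → ¬ q ^ e ∣ c := fun e =>
    PhamBrieskorn.not_dvd_of_notMem_setR hpq hpos hR (i := 1) (j := 2) (by decide) e
  have hRc : ∀ e, c ∣ q ^ e → ¬ q ^ e ∣ b := fun e =>
    PhamBrieskorn.not_dvd_of_notMem_setR hpq hpos hR (i := 2) (j := 1) (by decide) e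
  have hab : a.Coprime b := Nat.Coprime.coprime_dvd_right (dvd_mul_right _ _) hgcd
  have hac : a.Coprime c := Nat.Coprime.coprime_dvd_right (dvd_mul_left _ _) hgcd
  obtain ⟨b', c', hbc, hb, hc⟩ := Nat.exists_coprime b c
  generalize b.gcd c = g at hb hc
  subst hb hc
  have hb' : b' ≠ 0 := by rintro rfl; simp at hb0
  have hc' : c' ≠ 0 := by rintro rfl; simp at hc0
  have hg : g ≠ 0 := by rintro rfl; simp at hb0
  exact ⟨PhamBrieskorn.isDomain_PBRing ha0.ne' hb' hc' hg hbc hab hac,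
    PhamBrieskorn.isRigid_PBRing q hbc hab hac (by omega) (by omega) (by omega) hT hRb hRc⟩
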